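/- Let $M$ be a (Hausdorff) complex manifold of complex dimension $N$ with a Kähler metric, given in local holomorphic coordinates by $g_{k\bar l}=\partial_k\partial_{\bar l}\Phi$ with $\Phi$ a local real-valued Kähler potential. Let $(g^{\bar k l})$ be the inverse matrix of $(g_{k\bar l})$, put $g^{l\bar k}=g^{\bar k l}$, and write (summing over repeated indices) $$D^{\bar i}=g^{\bar i j}\partial_j,\qquad D^{i}=g^{i\bar j}\partial_{\bar j},\qquad \{p,f\}=-i\,(D^ip)\,\partial_i f+i\,(D^{\bar i}p)\,\partial_{\bar i}f .$$ Let $C^\infty(M)$ be the smooth complex-valued functions on $M$, and let $f*g=\sum_{k\ge 0}\hbar^kC_k(f,g)$ be Karabegov's star product with separation of variables on $C^\infty(M)[[\hbar]]$, that is: $*$ is $\mathbb C[[\hbar]]$-bilinear and associative; each $C_k$ is a bidifferential operator; $C_0(f,g)=fg$; $C_1(f,g)-C_1(g,f)=i\{f,g\}$; $f*1=1*f=f$; on every open set, $a*f=af$ for holomorphic $a$ and $f*b=fb$ for antiholomorphic $b$; and for every $f$ the left multiplication $L_f\colon g\mapsto f*g$ satisfies $[L_f,\ \partial_{\bar i}\Phi+\hbar\,\partial_{\bar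 i}]=0$ for all $i$, for every local Kähler potential $\Phi$ in all local holomorphic coordinates. Let $P=\sum_n\hbar^nP^{(n)}\in C^\infty(M)[[\hbar]]$ and $[P,f]_*=P*f-f*P$. Then $$[P,f]_*=i\hbar\{P,f\}\quad\text{for all } f\in C^\infty(M)$$ if and only if, in all local holomorphic coordinates, $$D^iD^jP=0\quad\text{and}\quad D^{\bar i}D^{\bar j}P=0\qquad\text{for all } i,j=1,\dots,N .$$ In particular, when these conditions hold, the inner derivation $f\mapsto[P,f]_*$ is given by a (formal) vector field: for every $n$ the coefficient of $\hbar^n$ in $[P,f]_*$ is obtained by applying a derivation of the commutative algebra $C^\infty(M)$ to $f$. -/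

import Mathlib

open scoped Manifold ContDiff PowerSeries

noncomputable section

namespace KahlerStar

/-- The model space `ℂ^N` of an `N`-dimensional complex manifold. -/
abbrev Cn (N : ℕ) : Type := Fin N → ℂ

variable {N : ℕ} {M : Type*} [TopologicalSpace M] [ChartedSpace (Cn N) M]

/-- The local holomorphic coordinate systems of the complex manifold `M`. -/
def holCharts (N : ℕ) (M : Type*) [TopologicalSpace M] [ChartedSpace (Cn N) M] :
    Set (OpenPartialHomeomorph M (Cn N)) :=
  IsManifold.maximalAtlas 𝓘(ℂ, Cn N) ω M

/-- `∂_k f = ∂f/∂z^k = (∂f/∂x^k - i ∂f/∂y^k)/2` in the coordinates `z = e` (used on `e.source`). -/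
def dz (e : OpenPartialHomeomorph M (Cn N)) (k : Fin N) (f : M → ℂ) : M → ℂ := fun y =>
  (1 / 2 : ℂ) * (fderiv ℝ (f ∘ e.symm) (e y) (Pi.single k 1)
    - Complex.I * fderiv ℝ (f ∘ e.symm) (e y) (Pi.single k Complex.I))

/-- `∂_{k̄} f = ∂f/∂z̄^k = (∂f/∂x^k + i ∂f/∂y^k)/2` in the coordinates `z = e`. -/
def dzbar (e : OpenPartialHomeomorph M (Cn N)) (k : Fin N) (f : M → ℂ) : M → ℂ := fun y =>
  (1 / 2 : ℂ) * (fderiv ℝ (f ∘ e.symm) (e y) (Pi.single k 1)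
    + Complex.I * fderiv ℝ (f ∘ e.symm) (e y) (Pi.single k Complex.I))

/-- Iterated partial derivatives; `inl k` stands for `∂_k` and `inr k` for `∂_{k̄}`. -/
def iterD (e : OpenPartialHomeomorph M (Cn N)) :
    List (Fin N ⊕ Fin N) → (M → ℂ) → (M → ℂ)
  | [], f => f
  | Sum.inl k :: w, f => dz e k (iterD e w f)
  | Sum.inr k :: w, f => dzbar e k (iterD e w f)

/-! ### Kähler metrics -/

/-- A Hermitian metric on the holomorphic tangent bundle, not yet required to be smooth. -/
structure HermitianForm (N : ℕ) (M : Type*) [TopologicalSpace M] [ChartedSpace (Cn N) M] where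
  /-- linear in the first, conjugate-linear in the second argument -/
  toFun : ∀ x : M, TangentSpace 𝓘(ℂ, Cn N) x →ₗ[ℂ] TangentSpace 𝓘(ℂ, Cn N) x →ₗ⋆[ℂ] ℂ
  conj_symm : ∀ (x : M) (v w : TangentSpace 𝓘(ℂ, Cn N) x),
    (starRingEnd ℂ) (toFun x v w) = toFun x w v
  pos : ∀ (x : M) (v : TangentSpace 𝓘(ℂ, Cn N) x), v ≠ 0 → 0 < (toFun x v v).re

/-- The matrix `g_{k l̄}(y) = h(∂_k, ∂_l)` in the coordinates `e`, for `y ∈ e.source`. -/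
def HermitianForm.gMat (h : HermitianForm N M) (e : OpenPartialHomeomorph M (Cn N)) (y : M) :
    Matrix (Fin N) (Fin N) ℂ := fun k l =>
  h.toFun (e.symm (e y))
    (mfderiv 𝓘(ℂ, Cn N) 𝓘(ℂ, Cn N) e.symm (e y) (Pi.single k 1 : Cn N))
    (mfderiv 𝓘(ℂ, Cn N) 𝓘(ℂ, Cn N) e.symm (e y) (Pi.single l 1 : Cn N))

/-- `Φ` is a Kähler potential of `h` on the open set `U`: it is smooth on `U`, and
`g_{k l̄} = ∂_k ∂_{l̄} Φ` on `U` in all holomorphic coordinates. -/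
def HermitianForm.IsPotentialOn (h : HermitianForm N M) (U : Set M) (Φ : M → ℝ) : Prop :=
  ContMDiffOn 𝓘(ℝ, Cn N) 𝓘(ℝ, ℝ) ∞ Φ U ∧
  ∀ e ∈ holCharts N M, ∀ y ∈ U ∩ e.source, ∀ k l : Fin N,
    h.gMat e y k l = dz e k (dzbar e l (fun x => (Φ x : ℂ))) y

/-- A Kähler metric: a Hermitian metric that has a Kähler potential near every point. -/
structure KahlerMetric (N : ℕ) (M : Type*) [TopologicalSpace M] [ChartedSpace (Cn N) M]
    extends HermitianForm N M where
  exists_potential : ∀ x : M, ∃ (U : Set M) (Φ : M → ℝ),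
    IsOpen U ∧ x ∈ U ∧ toHermitianForm.IsPotentialOn U Φ

/-- `D^{ī} f = g^{ī j} ∂_j f`, where `(g^{ī j})` is the inverse matrix of `(g_{j ī})`. -/
def KahlerMetric.Dbar (K : KahlerMetric N M) (e : OpenPartialHomeomorph M (Cn N)) (i : Fin N)
    (f : M → ℂ) : M → ℂ := fun y =>
  ∑ j, (K.gMat e y)⁻¹ i j * dz e j f y

/-- `D^i f = g^{i j̄} ∂_{j̄} f`, where `g^{i j̄} = g^{j̄ i}`. -/
def KahlerMetric.D (K : KahlerMetric N M) (e : OpenPartialHomeomorph M (Cn N)) (i : Fin N)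
    (f : M → ℂ) : M → ℂ := fun y =>
  ∑ j, (K.gMat e y)⁻¹ j i * dzbar e j f y

/-- The Poisson bracket `{p, f} = -i D^i p ∂_i f + i D^{ī} p ∂_{ī} f` of the Kähler form
`i g_{k l̄} dz^k ∧ dz̄^l`. It does not depend on the coordinates, so at `y` we compute it in the
preferred chart. -/
def KahlerMetric.poisson (K : KahlerMetric N M) (p f : M → ℂ) : M → ℂ := fun y =>
  let e := chartAt (Cn N) y
  ∑ i, (-Complex.I * K.D e i p y * dz e i f y + Complex.I * K.Dbar e i p y * dzbar e i f y)

/-! ### Formal functions and star products -/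

/-- The algebra `C^∞(M)` of smooth complex-valued functions (smooth in the real sense). -/
def smoothFun (N : ℕ) (M : Type*) [TopologicalSpace M] [ChartedSpace (Cn N) M] :
    Subalgebra ℂ (M → ℂ) where
  carrier := {f | ContMDiff 𝓘(ℝ, Cn N) 𝓘(ℝ, ℂ) ∞ f}
  mul_mem' := fun {_ _} hf hg =>
    (contDiff_mul (𝕜 := ℝ) (𝔸 := ℂ)).contMDiff.comp (ContMDiff.prodMk_space hf hg)
  add_mem' := fun {_ _} hf hg => ContMDiff.add hf hg
  algebraMap_mem' := fun _ => contMDiff_const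

/-- The set `ℱ = C^∞(M)[[ħ]]`; the variable of the power series is `ħ`. -/
abbrev Formal (N : ℕ) (M : Type*) [TopologicalSpace M] [ChartedSpace (Cn N) M] : Type _ :=
  (smoothFun N M)⟦X⟧

/-- A formal smooth function, regarded as a power series of plain functions. -/
def Formal.coe (F : Formal N M) : (M → ℂ)⟦X⟧ := PowerSeries.map (smoothFun N M).val.toRingHom F

/-- Bidifferential operators on `M`: near every point of every coordinate domain,
`C(f, g)` is a finite sum of terms `c · ∂^v f · ∂^w g` with smooth `c`. -/
def IsBidifferential (C : smoothFun N M →ₗ[ℂ] smoothFun N M →ₗ[ℂ] smoothFun N M) : Prop :=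
  ∀ e ∈ holCharts N M, ∀ x ∈ e.source, ∃ U : Set M, IsOpen U ∧ x ∈ U ∧ U ⊆ e.source ∧
    ∃ (S : Finset (List (Fin N ⊕ Fin N) × List (Fin N ⊕ Fin N)))
      (c : List (Fin N ⊕ Fin N) × List (Fin N ⊕ Fin N) → M → ℂ),
      (∀ s ∈ S, ContMDiffOn 𝓘(ℝ, Cn N) 𝓘(ℝ, ℂ) ∞ (c s) U) ∧
      ∀ f g : smoothFun N M, ∀ y ∈ U,
        (C f g : M → ℂ) y = ∑ s ∈ S, c s y * iterD e s.1 f y * iterD e s.2 g y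

/-- The `ħ`-bilinear product `f * g = ∑_k ħ^k C_k(f, g)` on `C^∞(M)[[ħ]]`. -/
def starProd (C : ℕ → smoothFun N M →ₗ[ℂ] smoothFun N M →ₗ[ℂ] smoothFun N M)
    (f g : Formal N M) : Formal N M :=
  PowerSeries.mk fun n => ∑ p ∈ Finset.HasAntidiagonal.antidiagonal n, ∑ q ∈ Finset.HasAntidiagonal.antidiagonal p.2,
    C p.1 (PowerSeries.coeff q.1 f) (PowerSeries.coeff q.2 g)

/-- A star product on the Kähler manifold `(M, K)`. -/
structure StarProduct (K : KahlerMetric N M) where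
  C : ℕ → smoothFun N M →ₗ[ℂ] smoothFun N M →ₗ[ℂ] smoothFun N M
  assoc : ∀ f g h : Formal N M,
    starProd C (starProd C f g) h = starProd C f (starProd C g h)
  bidifferential : ∀ k, IsBidifferential (C k)
  C_zero : ∀ f g : smoothFun N M, C 0 f g = f * g
  C_one : ∀ f g : smoothFun N M,
    (C 1 f g : M → ℂ) - (C 1 g f : M → ℂ) = Complex.I • K.poisson f g
  mul_one : ∀ f : Formal N M, starProd C f 1 = f
  one_mul : ∀ f : Formal N M, starProd C 1 f = f

/-- Separation of variables: `a * f = a f` and `f * b = f b` for holomorphic `a` and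
antiholomorphic `b`. Since the `C_k` are local and there may be few holomorphic functions on all
of `M`, this is asked on every open set where `a` is holomorphic, `b` antiholomorphic. -/
def StarProduct.SeparatesVariables {K : KahlerMetric N M} (S : StarProduct K) : Prop :=
  (∀ (U : Set M) (a f : smoothFun N M), IsOpen U →
    MDifferentiableOn 𝓘(ℂ, Cn N) 𝓘(ℂ, ℂ) (a : M → ℂ) U →
    ∀ k, ∀ y ∈ U, PowerSeries.coeff k
        (Formal.coe (starProd S.C (PowerSeries.C a) (PowerSeries.C f))) y
      = PowerSeries.coeff k (Formal.coe (PowerSeries.C (a * f))) y) ∧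
  (∀ (U : Set M) (b f : smoothFun N M), IsOpen U →
    MDifferentiableOn 𝓘(ℂ, Cn N) 𝓘(ℂ, ℂ) (fun x => (starRingEnd ℂ) ((b : M → ℂ) x)) U →
    ∀ k, ∀ y ∈ U, PowerSeries.coeff k
        (Formal.coe (starProd S.C (PowerSeries.C f) (PowerSeries.C b))) y
      = PowerSeries.coeff k (Formal.coe (PowerSeries.C (f * b))) y)

/-- The operator `∂_{ī}Φ + ħ ∂_{ī}` on formal functions, in the coordinates `e`. -/
def potentialOp (e : OpenPartialHomeomorph M (Cn N)) (i : Fin N) (Φ : M → ℝ)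
    (G : (M → ℂ)⟦X⟧) : (M → ℂ)⟦X⟧ :=
  PowerSeries.C (dzbar e i (fun x => (Φ x : ℂ))) * G
    + PowerSeries.X * PowerSeries.mk fun n => dzbar e i (PowerSeries.coeff n G)

/-- Karabegov's condition `[L_f, ∂_{ī}Φ + ħ ∂_{ī}] = 0` for every `f`, every local Kähler potential
`Φ` (on an open set `U`) and all holomorphic coordinates `e`. As `∂_{ī}Φ` is only local, `L_f` is
applied to a global `u` that agrees with `(∂_{ī}Φ + ħ ∂_{ī}) g` on `U ∩ e.source`. -/
def StarProduct.KarabegovCondition {K : KahlerMetric N M} (S : StarProduct K) : Prop :=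
  ∀ (U : Set M) (Φ : M → ℝ), IsOpen U → K.IsPotentialOn U Φ →
    ∀ e ∈ holCharts N M, ∀ (i : Fin N) (f g u : Formal N M),
      (∀ n, ∀ y ∈ U ∩ e.source,
        PowerSeries.coeff n u.coe y = PowerSeries.coeff n (potentialOp e i Φ g.coe) y) →
      ∀ n, ∀ y ∈ U ∩ e.source,
        PowerSeries.coeff n (starProd S.C f u).coe y
          = PowerSeries.coeff n (potentialOp e i Φ (starProd S.C f g).coe) y

/-- The star commutator `[P, f]_* = P * f - f * P`. -/
def StarProduct.comm {K : KahlerMetric N M} (S : StarProduct K) (P f : Formal N M) :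
    Formal N M :=
  starProd S.C P f - starProd S.C f P

/-- The Poisson bracket `{P, f}` of a formal function and a function, coefficientwise in `ħ`. -/
def KahlerMetric.formalPoisson (K : KahlerMetric N M) (P : Formal N M) (f : smoothFun N M) :
    (M → ℂ)⟦X⟧ :=
  PowerSeries.mk fun n => K.poisson (PowerSeries.coeff n P.coe) f

/-- `D^i D^j P = 0` and `D^{ī} D^{j̄} P = 0` for all `i, j`, in all holomorphic coordinates and at
every order in `ħ`. -/
def KahlerMetric.KillingEquations (K : KahlerMetric N M) (P : Formal N M) : Prop :=
  ∀ e ∈ holCharts N M, ∀ i j : Fin N, ∀ n, ∀ y ∈ e.source,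
    K.D e i (K.D e j (PowerSeries.coeff n P.coe)) y = 0 ∧
    K.Dbar e i (K.Dbar e j (PowerSeries.coeff n P.coe)) y = 0

end KahlerStar

end

noncomputable section

namespace KahlerStar

open Filter Topology Finset

set_option linter.unusedSectionVars false

section

/-! ### Parametric integrals and Hadamard's lemma -/

section Hadamard

variable {E F : Type} [NormedAddCommGroup E] [NormedSpace ℝ E] [FiniteDimensional ℝ E]
  [NormedAddCommGroup F] [NormedSpace ℝ F]

/-! Write `L_P` and `R_P` for left and right star multiplication by `P`, and `v_l = ∂_l Φ`, `w_l =
∂_{l̄} Φ`. The proof rests on a uniqueness principle. A local formal operator that commutes with the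
multiplications by `z̄^l` and with the operators `w_l + ħ ∂_{l̄}` is determined by its value on `1`
(`IntertwinesOn.eqOn`). Indeed `∂_k w_l = g_{k l̄}` is invertible, so `z̄, w` generate the ideal of
germs vanishing at each point. If two such operators agree on `1`, each coefficient of their
difference, once the lower ones vanish, commutes with `z̄, w` and kills `1`, so it vanishes by
Hadamard's lemma.

`L_P` is such an operator, by separation of variables and Karabegov's condition. Uniqueness applied
to `L_{v_l}` gives `v_l * f = v_l f + ħ ∂_l f` (`CoordFrame.C_v`), and by associativity `R_P` then
commutes with `z^l` and `v_l + ħ ∂_l`. Uniqueness at first order gives `C_1(f, g) = (D^i f) ∂_i g`,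
so `i{P, ·}` is the difference of `X_P = (D^i P) ∂_i` and `X̄_P = (D^{ī} P) ∂_{ī}` in every
coordinate system.

If the Killing equations hold, then `∂_{l̄} D^i P = 0`, so `X_P` commutes with `∂_{l̄}` and `P + ħ
X_P` satisfies the characterisation of `L_P`; hence `L_P = P + ħ X_P`. Likewise `R_P = P + ħ X̄_P`,
and subtracting gives `iħ{P, ·}`. Conversely, suppose `L_P - R_P = ħ Y` with `Y = X_P - X̄_P`. Since
`R_P` commutes with `z^j`, the relation between `L_P` and `w_l + ħ ∂_{l̄}` on `z^j` reduces to
`∂_{l̄} (Y z^j) = ∂_{l̄} D^j P = 0` (`IntertwinesOn.deriv_apply_eq_zero`). Exchanging the roles of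
`L_P` and `R_P` gives the conjugate equation.

The star product acts on global functions only, so coordinates, their derivations and the
potential's derivatives are globalised by cutoffs (`CoordFrame`), and locality makes the choices
irrelevant. -/

lemma hasFDerivAt_intervalIntegral_param {G : E × ℝ → F}
    (hG : ContDiff ℝ 1 G) (x₀ : E) :
    HasFDerivAt (fun x => ∫ t in (0 : ℝ)..1, G (x, t))
      (∫ t in (0 : ℝ)..1, (fderiv ℝ G (x₀, t)).comp (ContinuousLinearMap.inl ℝ E ℝ)) x₀ := by
  have : ProperSpace E := FiniteDimensional.proper ℝ E
  have hcont : Continuous fun q : E × ℝ =>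
      (fderiv ℝ G q).comp (ContinuousLinearMap.inl ℝ E ℝ) :=
    (hG.continuous_fderiv one_ne_zero).clm_comp continuous_const
  -- A constant dominates the partial derivative, by compactness of a ball times the unit interval.
  obtain ⟨B, hB⟩ := ((isCompact_closedBall x₀ 1).prod (isCompact_Icc (a := (0 : ℝ)) (b := 1)))
    |>.exists_bound_of_continuousOn hcont.continuousOn
  refine intervalIntegral.hasFDerivAt_integral_of_dominated_of_fderiv_le
    (F' := fun x t => (fderiv ℝ G (x, t)).comp (ContinuousLinearMap.inl ℝ E ℝ))
    (bound := fun _ => B) (Metric.ball_mem_nhds x₀ one_pos) (Eventually.of_forall fun x => ?_)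
    ?_ ?_ (Eventually.of_forall fun t ht x hx => ?_) intervalIntegrable_const
    (Eventually.of_forall fun t _ x _ => ?_)
  · exact (hG.continuous.comp (by fun_prop : Continuous fun t : ℝ => (x, t))).aestronglyMeasurable
  · exact (hG.continuous.comp (by fun_prop : Continuous fun t : ℝ => (x₀, t))).intervalIntegrable
      _ _
  · exact (hcont.comp (by fun_prop : Continuous fun t : ℝ => (x₀, t))).aestronglyMeasurable
  · rw [Set.uIoc_of_le zero_le_one] at ht
    exact hB (x, t) ⟨Metric.ball_subset_closedBall hx, ht.1.le, ht.2⟩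
  · have h := (hG.differentiable one_ne_zero (x, t)).hasFDerivAt
    exact h.comp x (hasFDerivAt_prodMk_left x t)

/-- The derivative of a parametric integral is the parametric integral of a partial derivative,
which takes values in `E →L[ℝ] F`. The induction on `n` therefore has to quantify over the target
space. -/
lemma contDiff_nat_intervalIntegral_param (n : ℕ) :
    ∀ {F : Type} [NormedAddCommGroup F] [NormedSpace ℝ F] {G : E × ℝ → F}, ContDiff ℝ ∞ G →
      ContDiff ℝ n fun x => ∫ t in (0 : ℝ)..1, G (x, t) := by
  induction n with
  | zero =>
    intro F _ _ G hG
    have hG1 : ContDiff ℝ 1 G := hG.of_le (by exact_mod_cast le_top)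
    exact contDiff_zero.2 <| continuous_iff_continuousAt.2 fun x =>
      (hasFDerivAt_intervalIntegral_param hG1 x).continuousAt
  | succ n ih =>
    intro F _ _ G hG
    have hG1 : ContDiff ℝ 1 G := hG.of_le (by exact_mod_cast le_top)
    push_cast
    refine contDiff_succ_iff_hasFDerivAt.2
      ⟨_, ?_, fun x => hasFDerivAt_intervalIntegral_param hG1 x⟩
    refine ih (G := fun q => (fderiv ℝ G q).comp (ContinuousLinearMap.inl ℝ E ℝ)) ?_
    exact (hG.fderiv_right (m := ∞) (by simp)).clm_comp contDiff_const

lemma contDiff_intervalIntegral_param {G : E × ℝ → F} (hG : ContDiff ℝ ∞ G) :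
    ContDiff ℝ ∞ fun x => ∫ t in (0 : ℝ)..1, G (x, t) :=
  contDiff_infty.2 fun n => contDiff_nat_intervalIntegral_param n hG

/-- Hadamard's lemma: `f x = f p + A(x) (x - p)` with `A` smooth. -/
lemma exists_contDiff_hadamard [CompleteSpace F] {f : E → F} (hf : ContDiff ℝ ∞ f) (p : E) :
    ∃ A : E → E →L[ℝ] F, ContDiff ℝ ∞ A ∧ ∀ x, f x = f p + A x (x - p) := by
  have hG : ContDiff ℝ ∞ fun q : E × ℝ => fderiv ℝ f (p + q.2 • (q.1 - p)) :=
    (hf.fderiv_right (m := ∞) (by simp)).comp (by fun_prop)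
  -- The witness is `A x = ∫₀¹ f'(p + t (x - p)) dt`; the identity is the fundamental theorem of
  -- calculus along the segment from `p` to `x`.
  refine ⟨_, contDiff_intervalIntegral_param hG, fun x => ?_⟩
  have hc : Continuous fun t : ℝ => fderiv ℝ f (p + t • (x - p)) :=
    hG.continuous.comp (by fun_prop : Continuous fun t : ℝ => (x, t))
  change f x = f p + (∫ t in (0 : ℝ)..1, fderiv ℝ f (p + t • (x - p))) (x - p)
  rw [ContinuousLinearMap.intervalIntegral_apply (hc.intervalIntegrable _ _)]
  have hd : ∀ t ∈ Set.uIcc (0 : ℝ) 1,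
      HasDerivAt (fun t : ℝ => f (p + t • (x - p))) (fderiv ℝ f (p + t • (x - p)) (x - p)) t := by
    intro t _
    have h1 := (hf.differentiable (by simp) (p + t • (x - p))).hasFDerivAt
    have h2 : HasDerivAt (fun t : ℝ => p + t • (x - p)) (x - p) t := by
      simpa using ((hasDerivAt_id t).smul_const (x - p)).const_add p
    exact h1.comp_hasDerivAt t h2
  rw [intervalIntegral.integral_eq_sub_of_hasDerivAt hd
    ((hc.clm_apply continuous_const).intervalIntegrable _ _)]
  simp

end Hadamard

/-! ### The underlying real manifold -/

variable {N : ℕ} {M : Type*} [TopologicalSpace M] [ChartedSpace (Cn N) M]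

lemma contDiffGroupoid_complex_le_real :
    contDiffGroupoid ω 𝓘(ℂ, Cn N) ≤ contDiffGroupoid ∞ 𝓘(ℝ, Cn N) := by
  refine groupoid_of_pregroupoid_le _ _ fun f s hf => ?_
  exact (ContDiffOn.restrict_scalars ℝ hf).of_le le_top

lemma holCharts_subset_real :
    holCharts N M ⊆ IsManifold.maximalAtlas 𝓘(ℝ, Cn N) ∞ M :=
  StructureGroupoid.maximalAtlas_mono contDiffGroupoid_complex_le_real

lemma isManifold_real [IsManifold 𝓘(ℂ, Cn N) ω M] : IsManifold 𝓘(ℝ, Cn N) ∞ M := by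
  have : HasGroupoid M (contDiffGroupoid ∞ 𝓘(ℝ, Cn N)) :=
    hasGroupoid_of_le (G₁ := contDiffGroupoid ω 𝓘(ℂ, Cn N)) inferInstance
      contDiffGroupoid_complex_le_real
  exact IsManifold.mk' _ _ _

/-- Smoothness of a complex-valued function at a point, in the real sense. -/
abbrev SmoothAt (N : ℕ) {M : Type*} [TopologicalSpace M] [ChartedSpace (Cn N) M]
    (f : M → ℂ) (x : M) : Prop := ContMDiffAt 𝓘(ℝ, Cn N) 𝓘(ℝ, ℂ) ∞ f x

variable {e : OpenPartialHomeomorph M (Cn N)} {f g : M → ℂ} {x : M}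

lemma SmoothAt.contDiffAt (hf : SmoothAt N f x) (he : e ∈ holCharts N M) (hx : x ∈ e.source) :
    ContDiffAt ℝ ∞ (f ∘ e.symm) (e x) := by
  have hs := contMDiffAt_symm_of_mem_maximalAtlas (holCharts_subset_real he) (e.map_source hx)
  rw [← contMDiffAt_iff_contDiffAt]
  refine ContMDiffAt.comp (e x) ?_ hs
  rwa [e.left_inv hx]

lemma smoothAt_comp_chart {F : Cn N → ℂ} (hF : ContDiffAt ℝ ∞ F (e x))
    (he : e ∈ holCharts N M) (hx : x ∈ e.source) : SmoothAt N (F ∘ e) x :=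
  ContMDiffAt.comp x (contMDiffAt_iff_contDiffAt.2 hF)
    (contMDiffAt_of_mem_maximalAtlas (holCharts_subset_real he) hx)

/-! ### Wirtinger derivatives -/

/-- `(∂/∂x^k + s ∂/∂y^k) / 2` on `ℂ^N`: this is `∂_k` for `s = -i` and `∂_{k̄}` for `s = i`. -/
def wirtinger (s : ℂ) (k : Fin N) (F : Cn N → ℂ) : Cn N → ℂ := fun z =>
  (1 / 2 : ℂ) * (fderiv ℝ F z (Pi.single k 1) + s * fderiv ℝ F z (Pi.single k Complex.I))

lemma dz_eq (k : Fin N) (f : M → ℂ) :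
    dz e k f = wirtinger (-Complex.I) k (f ∘ e.symm) ∘ e := by
  funext y; simp [dz, wirtinger, sub_eq_add_neg]

variable {s : ℂ} {k : Fin N} {F G : Cn N → ℂ} {z : Cn N}

lemma wirtinger_congr (h : F =ᶠ[𝓝 z] G) : wirtinger s k F =ᶠ[𝓝 z] wirtinger s k G := by
  filter_upwards [h.fderiv (𝕜 := ℝ)] with y hy
  simp only [wirtinger, hy]

lemma contDiffAt_wirtinger (hF : ContDiffAt ℝ ∞ F z) : ContDiffAt ℝ ∞ (wirtinger s k F) z := by
  have h := hF.fderiv_right (m := ∞) (by simp)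
  unfold wirtinger
  fun_prop

lemma wirtinger_add (hF : DifferentiableAt ℝ F z) (hG : DifferentiableAt ℝ G z) :
    wirtinger s k (F + G) z = wirtinger s k F z + wirtinger s k G z := by
  simp only [wirtinger, fderiv_add hF hG, add_apply]; ring

lemma wirtinger_mul (hF : DifferentiableAt ℝ F z) (hG : DifferentiableAt ℝ G z) :
    wirtinger s k (F * G) z = F z * wirtinger s k G z + G z * wirtinger s k F z := by
  simp only [wirtinger, fderiv_mul hF hG, add_apply,
    smul_apply, smul_eq_mul]; ring

lemma wirtinger_const (c : ℂ) : wirtinger s k (fun _ => c) z = 0 := by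
  simp [wirtinger]

lemma wirtinger_comm {s' : ℂ} {k' : Fin N} (hF : ContDiffAt ℝ ∞ F z) :
    wirtinger s k (wirtinger s' k' F) z = wirtinger s' k' (wirtinger s k F) z := by
  have hd : DifferentiableAt ℝ (fderiv ℝ F) z :=
    (hF.fderiv_right (m := ∞) (by simp)).differentiableAt (by simp)
  have key : ∀ (s : ℂ) (k : Fin N) (v : Cn N), fderiv ℝ (wirtinger s k F) z v
      = (1 / 2 : ℂ) * (fderiv ℝ (fderiv ℝ F) z v (Pi.single k 1)
        + s * fderiv ℝ (fderiv ℝ F) z v (Pi.single k Complex.I)) := by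
    intro s k v
    have h1 : ∀ u : Cn N, HasFDerivAt (fun y => fderiv ℝ F y u)
        ((fderiv ℝ (fderiv ℝ F) z).flip u) z := fun u => by
      simpa using hd.hasFDerivAt.clm_apply (hasFDerivAt_const u z)
    have h2 := ((h1 (Pi.single k 1)).add ((h1 (Pi.single k Complex.I)).const_mul s)).const_mul
      (1 / 2 : ℂ)
    rw [show wirtinger s k F = _ from rfl]
    erw [h2.fderiv]
    simp
    ring
  have hs : IsSymmSndFDerivAt ℝ F z := hF.isSymmSndFDerivAt (by simpa using WithTop.coe_le_coe.2 (le_top : (2 : ℕ∞) ≤ ⊤))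
  have e1 := fun u v => hs.eq u v
  simp only [wirtinger] at key ⊢
  simp only [key]
  rw [e1 (Pi.single k 1) (Pi.single k' 1), e1 (Pi.single k 1) (Pi.single k' Complex.I),
    e1 (Pi.single k Complex.I) (Pi.single k' 1),
    e1 (Pi.single k Complex.I) (Pi.single k' Complex.I)]
  ring

/-- The factor `(1 + s i) / 2` is `1` for `s = -i` and `0` for `s = i`, so both Wirtinger
derivatives are covered at once. -/
lemma wirtinger_coord (j : Fin N) :
    wirtinger s k (fun z => z j) z = if j = k then (1 + s * Complex.I) / 2 else 0 := by
  have h : fderiv ℝ (fun z : Cn N => z j) z = ContinuousLinearMap.proj j :=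
    (ContinuousLinearMap.proj (R := ℝ) (φ := fun _ : Fin N => ℂ) j).fderiv
  rw [wirtinger, h]
  by_cases hj : j = k
  · subst hj; simp; ring
  · simp [hj]

lemma wirtinger_conj_coord (j : Fin N) :
    wirtinger s k (fun z => (starRingEnd ℂ) (z j)) z
      = if j = k then (1 - s * Complex.I) / 2 else 0 := by
  have h : fderiv ℝ (fun z : Cn N => (starRingEnd ℂ) (z j)) z
      = (Complex.conjCLE : ℂ →L[ℝ] ℂ).comp (ContinuousLinearMap.proj j) :=
    ((Complex.conjCLE : ℂ →L[ℝ] ℂ).comp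
      (ContinuousLinearMap.proj (R := ℝ) (φ := fun _ : Fin N => ℂ) j)).fderiv
  rw [wirtinger, h]
  by_cases hj : j = k
  · subst hj; simp; ring
  · simp [hj]

/-- `wirtinger` in the coordinates `e`. -/
def chartDeriv (e : OpenPartialHomeomorph M (Cn N)) (s : ℂ) (k : Fin N) (f : M → ℂ) : M → ℂ :=
  wirtinger s k (f ∘ e.symm) ∘ e

lemma comp_symm_congr (hx : x ∈ e.source) (h : f =ᶠ[𝓝 x] g) :
    f ∘ e.symm =ᶠ[𝓝 (e x)] g ∘ e.symm := by
  have ht : Tendsto e.symm (𝓝 (e x)) (𝓝 x) := by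
    simpa [e.left_inv hx] using (e.continuousAt_symm (e.map_source hx)).tendsto
  exact ht.eventually h

lemma chartDeriv_congr (hx : x ∈ e.source) (h : f =ᶠ[𝓝 x] g) :
    chartDeriv e s k f =ᶠ[𝓝 x] chartDeriv e s k g :=
  (e.continuousAt hx).eventually (wirtinger_congr (comp_symm_congr hx h))

lemma SmoothAt.chartDeriv (hf : SmoothAt N f x) (he : e ∈ holCharts N M) (hx : x ∈ e.source) :
    SmoothAt N (chartDeriv e s k f) x :=
  smoothAt_comp_chart (contDiffAt_wirtinger (hf.contDiffAt he hx)) he hx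

lemma SmoothAt.differentiableAt (hf : SmoothAt N f x) (he : e ∈ holCharts N M)
    (hx : x ∈ e.source) : DifferentiableAt ℝ (f ∘ e.symm) (e x) :=
  (hf.contDiffAt he hx).differentiableAt (by simp)

lemma chartDeriv_add (he : e ∈ holCharts N M) (hx : x ∈ e.source)
    (hf : SmoothAt N f x) (hg : SmoothAt N g x) :
    chartDeriv e s k (f + g) x = chartDeriv e s k f x + chartDeriv e s k g x :=
  wirtinger_add (hf.differentiableAt he hx) (hg.differentiableAt he hx)

lemma chartDeriv_mul (he : e ∈ holCharts N M) (hx : x ∈ e.source)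
    (hf : SmoothAt N f x) (hg : SmoothAt N g x) :
    chartDeriv e s k (f * g) x = f x * chartDeriv e s k g x + g x * chartDeriv e s k f x := by
  have h := wirtinger_mul (s := s) (k := k) (hf.differentiableAt he hx)
    (hg.differentiableAt he hx)
  simp only [Function.comp_apply, e.left_inv hx] at h
  exact h

lemma chartDeriv_const (c : ℂ) : chartDeriv e s k (fun _ => c) x = 0 :=
  wirtinger_const c

lemma chartDeriv_comp_symm (hx : x ∈ e.source) :
    chartDeriv e s k f ∘ e.symm =ᶠ[𝓝 (e x)] wirtinger s k (f ∘ e.symm) := by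
  filter_upwards [e.open_target.mem_nhds (e.map_source hx)] with y hy
  simp [chartDeriv, e.right_inv hy]

lemma chartDeriv_comm {s' : ℂ} {k' : Fin N} (he : e ∈ holCharts N M) (hx : x ∈ e.source)
    (hf : SmoothAt N f x) :
    chartDeriv e s k (chartDeriv e s' k' f) x = chartDeriv e s' k' (chartDeriv e s k f) x := by
  have h1 := (wirtinger_congr (s := s) (k := k)
    (chartDeriv_comp_symm (s := s') (k := k') (f := f) hx)).eq_of_nhds
  have h2 := (wirtinger_congr (s := s') (k := k')
    (chartDeriv_comp_symm (s := s) (k := k) (f := f) hx)).eq_of_nhds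
  exact h1.trans ((wirtinger_comm (hf.contDiffAt he hx)).trans h2.symm)

lemma chartDeriv_comp_chart (hx : x ∈ e.source) (F : Cn N → ℂ) :
    chartDeriv e s k (F ∘ e) x = wirtinger s k F (e x) := by
  refine (wirtinger_congr ?_).eq_of_nhds
  filter_upwards [e.open_target.mem_nhds (e.map_source hx)] with y hy
  simp [e.right_inv hy]

lemma dz_eq_chartDeriv : dz e k f = chartDeriv e (-Complex.I) k f := dz_eq k f
lemma dzbar_eq_chartDeriv : dzbar e k f = chartDeriv e Complex.I k f := rfl

end

section

variable {N : ℕ} {M : Type*} [TopologicalSpace M] [ChartedSpace (Cn N) M]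
  {e : OpenPartialHomeomorph M (Cn N)} {x : M}

/-! ### Smooth functions: cutoffs and extension of germs -/

lemma smoothFun_smoothAt (f : smoothFun N M) (x : M) : SmoothAt N (f : M → ℂ) x :=
  (show ContMDiff 𝓘(ℝ, Cn N) 𝓘(ℝ, ℂ) ∞ (f : M → ℂ) from f.2) x

lemma SmoothAt.mul {f g : M → ℂ} (hf : SmoothAt N f x) (hg : SmoothAt N g x) :
    SmoothAt N (f * g) x :=
  ((contDiff_mul (𝕜 := ℝ) (𝔸 := ℂ)).contMDiff.contMDiffAt).comp x (hf.prodMk_space hg)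

/-- Source of all passages from local to global: a function or derivation defined on `W` is
multiplied by `χ` without changing its germ at `x`. -/
lemma exists_cutoff [T2Space M] [IsManifold 𝓘(ℂ, Cn N) ω M] {W : Set M} (hW : W ∈ 𝓝 x) :
    ∃ χ : smoothFun N M, tsupport (χ : M → ℂ) ⊆ W ∧ (χ : M → ℂ) =ᶠ[𝓝 x] 1 := by
  have : IsManifold 𝓘(ℝ, Cn N) ∞ M := isManifold_real
  obtain ⟨b, -, hb⟩ := (SmoothBumpFunction.nhds_basis_tsupport (I := 𝓘(ℝ, Cn N)) x).mem_iff.1 hW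
  refine ⟨⟨fun y => (b y : ℂ), ?_⟩, ?_, ?_⟩
  · exact (Complex.ofRealCLM.contDiff.contMDiff (n := ∞)).comp b.contMDiff
  · refine subset_trans (closure_mono fun y hy => ?_) hb
    simpa using hy
  · filter_upwards [b.eventuallyEq_one] with y hy
    simp [hy]

/-- The product of a cutoff function and of a function that is smooth near its support. -/
def cutoffMul (χ : smoothFun N M) (F : M → ℂ)
    (hF : ∀ y ∈ tsupport (χ : M → ℂ), SmoothAt N F y) : smoothFun N M :=
  ⟨(χ : M → ℂ) * F, contMDiff_of_tsupport fun y hy =>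
    (smoothFun_smoothAt χ y).mul (hF y (tsupport_mul_subset_left hy))⟩

lemma exists_smoothFun_eventuallyEq [T2Space M] [IsManifold 𝓘(ℂ, Cn N) ω M] {F : M → ℂ}
    (hF : ∀ᶠ y in 𝓝 x, SmoothAt N F y) : ∃ f : smoothFun N M, (f : M → ℂ) =ᶠ[𝓝 x] F := by
  obtain ⟨χ, hχ, h1⟩ := exists_cutoff (N := N) hF
  refine ⟨cutoffMul χ F fun y hy => hχ hy, ?_⟩
  filter_upwards [h1] with y hy
  simp [cutoffMul, hy]

lemma exists_inv_eventuallyEq [T2Space M] [IsManifold 𝓘(ℂ, Cn N) ω M] (f : smoothFun N M)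
    (hf : (f : M → ℂ) x ≠ 0) :
    ∃ g : smoothFun N M, ((g * f : smoothFun N M) : M → ℂ) =ᶠ[𝓝 x] 1 := by
  have hne : ∀ᶠ y in 𝓝 x, (f : M → ℂ) y ≠ 0 :=
    (smoothFun_smoothAt f x).continuousAt.eventually_ne hf
  have : ∀ᶠ y in 𝓝 x, SmoothAt N (fun y => ((f : M → ℂ) y)⁻¹) y := by
    filter_upwards [hne] with y hy
    exact (contDiffAt_inv ℝ hy).contMDiffAt.comp y (smoothFun_smoothAt f y)
  obtain ⟨g, hg⟩ := exists_smoothFun_eventuallyEq this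
  refine ⟨g, ?_⟩
  filter_upwards [hg, hne] with y hy h0
  simp [hy, h0]

/-! ### Coordinate derivations -/

/-- The derivation `χ · (∂/∂x^k + s ∂/∂y^k)/2` of `C^∞(M)`, for a cutoff function `χ` supported
in the coordinate domain. -/
def cutoffDeriv (he : e ∈ holCharts N M) (χ : smoothFun N M)
    (hχ : tsupport (χ : M → ℂ) ⊆ e.source) (s : ℂ) (k : Fin N) :
    Derivation ℂ (smoothFun N M) (smoothFun N M) :=
  Derivation.mk'
    { toFun := fun f => cutoffMul χ (chartDeriv e s k f)
        fun y hy => (smoothFun_smoothAt f y).chartDeriv he (hχ hy)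
      map_add' := fun f g => by
        refine Subtype.ext (funext fun y => ?_)
        by_cases hy : y ∈ tsupport (χ : M → ℂ)
        · have := chartDeriv_add (s := s) (k := k) he (hχ hy) (smoothFun_smoothAt f y)
            (smoothFun_smoothAt g y)
          simp only [cutoffMul, Pi.mul_apply, Subalgebra.coe_add, Pi.add_apply, this]
          ring
        · simp [cutoffMul, image_eq_zero_of_notMem_tsupport hy]
      map_smul' := fun c f => by
        refine Subtype.ext (funext fun y => ?_)
        by_cases hy : y ∈ tsupport (χ : M → ℂ)
        · have := chartDeriv_mul (s := s) (k := k) (f := fun _ => c) he (hχ hy) contMDiffAt_const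
            (smoothFun_smoothAt f y)
          rw [chartDeriv_const, mul_zero, add_zero] at this
          simp only [cutoffMul, Pi.mul_apply, Subalgebra.coe_smul, Pi.smul_apply,
            RingHom.id_apply, smul_eq_mul]
          rw [show (c • (f : M → ℂ)) = (fun _ => c) * (f : M → ℂ) from rfl, this]
          ring
        · simp [cutoffMul, image_eq_zero_of_notMem_tsupport hy] }
    fun f g => by
      refine Subtype.ext (funext fun y => ?_)
      by_cases hy : y ∈ tsupport (χ : M → ℂ)
      · have := chartDeriv_mul (s := s) (k := k) he (hχ hy) (smoothFun_smoothAt f y)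
          (smoothFun_smoothAt g y)
        simp only [LinearMap.coe_mk, AddHom.coe_mk, cutoffMul, Pi.mul_apply, Subalgebra.coe_mul,
          Subalgebra.coe_add, Pi.add_apply, smul_eq_mul, this]
        ring
      · simp [cutoffMul, image_eq_zero_of_notMem_tsupport hy]

lemma cutoffDeriv_apply (he : e ∈ holCharts N M) (χ : smoothFun N M)
    (hχ : tsupport (χ : M → ℂ) ⊆ e.source) (s : ℂ) (k : Fin N) (f : smoothFun N M) (y : M)
    (hy : (χ : M → ℂ) y = 1) :
    (cutoffDeriv he χ hχ s k f : M → ℂ) y = chartDeriv e s k f y := by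
  simp [cutoffDeriv, cutoffMul, hy]

/-! ### Hadamard's lemma on the manifold -/

/-- A real-linear map splits into its complex-linear and antilinear parts; applied to the Hadamard
factor this gives the coefficients of `z^k - p^k` and of the conjugates. -/
lemma clm_apply_eq_sum (A : Cn N →L[ℝ] ℂ) (v : Cn N) :
    A v = ∑ k, ((1 / 2 * (A (Pi.single k 1) - Complex.I * A (Pi.single k Complex.I))) * v k
      + (1 / 2 * (A (Pi.single k 1) + Complex.I * A (Pi.single k Complex.I)))
        * (starRingEnd ℂ) (v k)) := by
  have hv : v = ∑ k, ((v k).re • (Pi.single k 1 : Cn N)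
      + (v k).im • (Pi.single k Complex.I : Cn N)) := by
    funext j
    simp only [Finset.sum_apply, Pi.add_apply, Pi.smul_apply, Pi.single_apply]
    simp [Finset.sum_add_distrib, Complex.re_add_im]
  conv_lhs => rw [hv]
  rw [map_sum]
  refine Finset.sum_congr rfl fun k _ => ?_
  rw [map_add, map_smul, map_smul]
  generalize A (Pi.single k 1) = a
  generalize A (Pi.single k Complex.I) = b
  have h1 : (v k) = (v k).re + (v k).im * Complex.I := (Complex.re_add_im _).symm
  have h2 : (starRingEnd ℂ) (v k) = (v k).re - (v k).im * Complex.I := by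
    apply Complex.ext <;> simp
  rw [h2]
  conv_rhs => rw [h1]
  simp only [Complex.real_smul]
  simp only [Complex.add_re, Complex.ofReal_re, Complex.mul_re, Complex.I_re, Complex.I_im,
    Complex.ofReal_im, Complex.add_im, Complex.mul_im]
  ring_nf
  rw [Complex.I_sq]
  ring

/-- Near every `p` in the coordinate domain, a smooth function is
`f(p) + ∑ a_k (z^k - p^k) + ∑ b_k (z̄^k - p̄^k)` with smooth `a_k`, `b_k`. -/
lemma exists_hadamard_chart [T2Space M] [IsManifold 𝓘(ℂ, Cn N) ω M] (he : e ∈ holCharts N M)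
    (hx : x ∈ e.source) (f : smoothFun N M) :
    ∃ a b : Fin N → smoothFun N M, ∀ᶠ y in 𝓝 x, (f : M → ℂ) y = (f : M → ℂ) x
      + ∑ k, ((a k : M → ℂ) y * (e y k - e x k)
        + (b k : M → ℂ) y * ((starRingEnd ℂ) (e y k) - (starRingEnd ℂ) (e x k))) := by
  obtain ⟨χ, hχ, h1⟩ := exists_cutoff (N := N) (e.open_source.mem_nhds hx)
  -- Two cutoffs are needed: `c` on `ℂ^N` extends `f ∘ e.symm` to the whole space, where Hadamard's
  -- lemma applies, and `χ` on `M` makes the resulting coefficients global.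
  obtain ⟨c, hc, hc1⟩ := exists_cutoff (N := N) (M := Cn N) (e.open_target.mem_nhds
    (e.map_source hx))
  have hF : ContDiff ℝ ∞ ((c : Cn N → ℂ) * (f : M → ℂ) ∘ e.symm) := by
    rw [← contMDiff_iff_contDiff]
    refine contMDiff_of_tsupport fun z hz => ?_
    have hz' : z ∈ e.target := hc (tsupport_mul_subset_left hz)
    refine (smoothFun_smoothAt c z).mul (contMDiffAt_iff_contDiffAt.2 ?_)
    have := (smoothFun_smoothAt f (e.symm z)).contDiffAt he (e.map_target hz')
    rwa [e.right_inv hz'] at this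
  obtain ⟨A, hA, hfA⟩ := exists_contDiff_hadamard hF (e x)
  have hsm : ∀ (s : ℂ) (k : Fin N), ∀ y ∈ tsupport (χ : M → ℂ), SmoothAt N
      ((fun z => 1 / 2 * (A z (Pi.single k 1) + s * A z (Pi.single k Complex.I))) ∘ e) y := by
    intro s k y hy
    refine smoothAt_comp_chart (ContDiff.contDiffAt ?_) he (hχ hy)
    fun_prop
  refine ⟨fun k => cutoffMul χ _ (hsm (-Complex.I) k), fun k => cutoffMul χ _ (hsm Complex.I k),
    ?_⟩
  filter_upwards [h1, (e.continuousAt hx).eventually hc1, e.open_source.mem_nhds hx]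
    with y hy hcy hys
  have h := hfA (e y)
  have hcx : (c : Cn N → ℂ) (e x) = 1 := hc1.eq_of_nhds
  simp only [Pi.mul_apply, Function.comp_apply, hcy, e.left_inv hys, hcx, e.left_inv hx,
    Pi.one_apply, one_mul] at h
  rw [h, clm_apply_eq_sum]
  simp [cutoffMul, hy, sub_eq_add_neg]

end

section

variable {N : ℕ} {M : Type*} [TopologicalSpace M] [ChartedSpace (Cn N) M]

/-! ### Local operators on `C^∞(M)` -/

/-- The value of `T f` at a point of `V` depends only on the germ of `f` there. -/
def IsLocalOn (V : Set M) (T : smoothFun N M →ₗ[ℂ] smoothFun N M) : Prop :=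
  ∀ f : smoothFun N M, ∀ y ∈ V, (f : M → ℂ) =ᶠ[𝓝 y] 0 → (T f : M → ℂ) y = 0

variable {V : Set M} {T T' : smoothFun N M →ₗ[ℂ] smoothFun N M}

lemma IsLocalOn.congr (hT : IsLocalOn V T) {f g : smoothFun N M} {y : M} (hy : y ∈ V)
    (h : (f : M → ℂ) =ᶠ[𝓝 y] g) : (T f : M → ℂ) y = (T g : M → ℂ) y := by
  have := hT (f - g) y hy (by filter_upwards [h] with z hz; simp [hz])
  simpa [sub_eq_zero] using this

lemma IsLocalOn.congr_of_eqOn (hT : IsLocalOn V T) (hV : IsOpen V) {f g : smoothFun N M}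
    (h : Set.EqOn (f : M → ℂ) g V) : Set.EqOn (T f : M → ℂ) (T g) V := fun _ hy =>
  hT.congr hy (h.eventuallyEq_of_mem (hV.mem_nhds hy))

lemma IsLocalOn.add (hT : IsLocalOn V T) (hT' : IsLocalOn V T') : IsLocalOn V (T + T') :=
  fun f y hy h => by simp [hT f y hy h, hT' f y hy h]

lemma IsLocalOn.sub (hT : IsLocalOn V T) (hT' : IsLocalOn V T') : IsLocalOn V (T - T') :=
  fun f y hy h => by simp [hT f y hy h, hT' f y hy h]

lemma IsLocalOn.sum {ι : Type*} (s : Finset ι) {T : ι → smoothFun N M →ₗ[ℂ] smoothFun N M}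
    (hT : ∀ i ∈ s, IsLocalOn V (T i)) : IsLocalOn V (∑ i ∈ s, T i) := fun f y hy h => by
  simp only [LinearMap.sum_apply, AddSubmonoidClass.coe_finsetSum, Finset.sum_apply]
  exact Finset.sum_eq_zero fun i hi => hT i hi f y hy h

lemma isLocalOn_mulLeft (p : smoothFun N M) : IsLocalOn V (LinearMap.mulLeft ℂ p) :=
  fun f y _ h => by simp [h.eq_of_nhds]

section

variable [T2Space M] [IsManifold 𝓘(ℂ, Cn N) ω M]

/-- If `χ` is supported where `f` vanishes and `χ = 1` near `y`, then `0 = D (χ f) = χ D f + f D χ`,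
which at `y` reads `D f = 0`. -/
lemma isLocalOn_derivation (D : Derivation ℂ (smoothFun N M) (smoothFun N M)) :
    IsLocalOn V (D : smoothFun N M →ₗ[ℂ] smoothFun N M) := by
  intro f y _ h
  obtain ⟨W, hW, hWo, hyW⟩ := eventually_nhds_iff.1 h
  obtain ⟨χ, hχ, h1⟩ := exists_cutoff (N := N) (hWo.mem_nhds hyW)
  have h0 : χ * f = 0 := by
    refine Subtype.ext (funext fun z => ?_)
    by_cases hz : z ∈ tsupport (χ : M → ℂ)
    · simp [hW z (hχ hz)]
    · simp [image_eq_zero_of_notMem_tsupport hz]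
  have h2 := congrArg (fun g : smoothFun N M => (g : M → ℂ) y) (D.leibniz χ f)
  simpa [h0, h1.eq_of_nhds, h.eq_of_nhds] using h2.symm

lemma derivation_congr (D : Derivation ℂ (smoothFun N M) (smoothFun N M)) {f g : smoothFun N M}
    {y : M} (h : (f : M → ℂ) =ᶠ[𝓝 y] g) : (D f : M → ℂ) y = (D g : M → ℂ) y :=
  (isLocalOn_derivation (V := Set.univ) D).congr trivial h

lemma derivation_congr_on (D : Derivation ℂ (smoothFun N M) (smoothFun N M)) (hV : IsOpen V)
    {f g : smoothFun N M} (h : Set.EqOn (f : M → ℂ) g V) : Set.EqOn (D f : M → ℂ) (D g) V :=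
  (isLocalOn_derivation D).congr_of_eqOn hV h

end

/-! ### Functions that generate the ideals of points -/

/-- At every `p ∈ V` the germs vanishing at `p` are generated by the `φ_k - φ_k(p)` and
`ψ_k - ψ_k(p)`. -/
def HadamardOn (V : Set M) (φ ψ : Fin N → smoothFun N M) : Prop :=
  ∀ p ∈ V, ∀ f : smoothFun N M, ∃ a b : Fin N → smoothFun N M, ∀ᶠ y in 𝓝 p,
    (f : M → ℂ) y = (f : M → ℂ) p + ∑ k, ((a k : M → ℂ) y * ((φ k : M → ℂ) y - (φ k : M → ℂ) p)
      + (b k : M → ℂ) y * ((ψ k : M → ℂ) y - (ψ k : M → ℂ) p))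

variable {φ ψ ζ : Fin N → smoothFun N M}

lemma HadamardOn.symm (h : HadamardOn V φ ψ) : HadamardOn V ψ φ := fun p hp f => by
  obtain ⟨a, b, hab⟩ := h p hp f
  exact ⟨b, a, by simpa only [add_comm] using hab⟩

/-- A local operator that commutes with the functions `φ_k`, `ψ_k` and kills `1` vanishes. -/
lemma HadamardOn.eq_zero (h : HadamardOn V φ ψ) (hT : IsLocalOn V T)
    (hφ : ∀ k f, ∀ y ∈ V, (T (φ k * f) : M → ℂ) y = (φ k : M → ℂ) y * (T f : M → ℂ) y)
    (hψ : ∀ k f, ∀ y ∈ V, (T (ψ k * f) : M → ℂ) y = (ψ k : M → ℂ) y * (T f : M → ℂ) y)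
    (h1 : ∀ y ∈ V, (T 1 : M → ℂ) y = 0) (f : smoothFun N M) :
    ∀ y ∈ V, (T f : M → ℂ) y = 0 := by
  intro p hp
  obtain ⟨a, b, hab⟩ := h p hp f
  -- After `T` is applied to this expansion, each summand carries a factor `φ_k - φ_k(p)` or `ψ_k -
  -- ψ_k(p)`, which vanishes at `p`; only `f(p) T 1 = 0` is left.
  have hg := hT.congr (g := (f : M → ℂ) p • 1 + ∑ k,
    ((φ k * a k - (φ k : M → ℂ) p • a k) + (ψ k * b k - (ψ k : M → ℂ) p • b k))) hp (by
      filter_upwards [hab] with y hy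
      rw [hy]
      simp only [Subalgebra.coe_add, Subalgebra.coe_smul, AddSubmonoidClass.coe_finsetSum,
        AddSubgroupClass.coe_sub, Subalgebra.coe_mul, Pi.add_apply, Pi.smul_apply, Pi.sub_apply,
        Finset.sum_apply, Pi.mul_apply, smul_eq_mul, Subalgebra.coe_one, Pi.one_apply, mul_one]
      congr 1
      exact Finset.sum_congr rfl fun k _ => by ring)
  rw [hg]
  simp only [map_add, map_sum, map_sub, map_smul, Subalgebra.coe_add, Subalgebra.coe_smul,
    AddSubmonoidClass.coe_finsetSum, AddSubgroupClass.coe_sub, Pi.add_apply, Pi.smul_apply,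
    Pi.sub_apply, Finset.sum_apply, smul_eq_mul, h1 p hp, hφ _ _ p hp, hψ _ _ p hp]
  simp

/-- If `ζ`, `φ` are coordinates and the matrix `∂ψ_l/∂ζ_k` is invertible, then `φ`, `ψ` are
coordinates. -/
lemma HadamardOn.change [T2Space M] [IsManifold 𝓘(ℂ, Cn N) ω M] (h : HadamardOn V ζ φ)
    (D : Fin N → Derivation ℂ (smoothFun N M) (smoothFun N M))
    (hζ : ∀ k j, ∀ y ∈ V, (D k (ζ j) : M → ℂ) y = if j = k then 1 else 0)
    (hφ : ∀ k j, ∀ y ∈ V, (D k (φ j) : M → ℂ) y = 0)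
    (hdet : ∀ y ∈ V, (Matrix.of fun l k => (D k (ψ l) : M → ℂ) y).det ≠ 0) :
    HadamardOn V φ ψ := by
  intro p hp f
  choose a b hab using fun l => h p hp (ψ l)
  -- Applying `D k` to the expansion of `ψ_l` identifies its Hadamard coefficients at `p` with the
  -- Jacobian, so the coefficient matrix `A` is invertible near `p`.
  have ha : ∀ l k, (D k (ψ l) : M → ℂ) p = (a l k : M → ℂ) p := by
    intro l k
    rw [derivation_congr (D k) (g := (ψ l : M → ℂ) p • 1 + ∑ k,
      ((a l k * (ζ k - (ζ k : M → ℂ) p • 1)) + (b l k * (φ k - (φ k : M → ℂ) p • 1)))) (by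
        filter_upwards [hab l] with y hy
        rw [hy]
        simp)]
    simp [hζ _ _ p hp, hφ _ _ p hp]
  let A : Matrix (Fin N) (Fin N) (smoothFun N M) := Matrix.of a
  let B : Matrix (Fin N) (Fin N) (smoothFun N M) := Matrix.of b
  let ev : M → smoothFun N M →+* ℂ := fun y =>
    (Pi.evalRingHom (fun _ : M => ℂ) y).comp (smoothFun N M).val.toRingHom
  have hdetA : (A.det : M → ℂ) p ≠ 0 := by
    have h1 : (A.det : M → ℂ) p = ((ev p).mapMatrix A).det := RingHom.map_det (ev p) A
    rw [h1]
    convert hdet p hp using 2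
    ext l k
    exact (ha l k).symm
  obtain ⟨s, hs⟩ := exists_inv_eventuallyEq A.det hdetA
  obtain ⟨c, d, hcd⟩ := h p hp f
  -- Near `p` this is `c A⁻¹`, with `s` the local inverse of `det A`. Then `∑ q_l (ψ_l - ψ_l(p))`
  -- reproduces the `ζ`-part of the expansion of `f`, up to a `φ`-part with coefficients `q B` that
  -- is subtracted from `d`.
  let q : Fin N → smoothFun N M := s • Matrix.vecMul c A.adjugate
  have hq : Matrix.vecMul q A = (s * A.det) • c := by
    simp only [q, Matrix.smul_vecMul, Matrix.vecMul_vecMul, Matrix.adjugate_mul,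
      Matrix.vecMul_smul, Matrix.vecMul_one, smul_smul]
  refine ⟨d - Matrix.vecMul q B, q, ?_⟩
  filter_upwards [hcd, hs, eventually_all.2 hab] with y hy hsy hψ
  have hqy : ∀ k, ∑ l, (q l : M → ℂ) y * (a l k : M → ℂ) y = (c k : M → ℂ) y := by
    intro k
    have := congrArg (fun g : smoothFun N M => (g : M → ℂ) y) (congrFun hq k)
    simp only [Matrix.vecMul, dotProduct, AddSubmonoidClass.coe_finsetSum, Finset.sum_apply,
      Pi.smul_apply, smul_eq_mul, Subalgebra.coe_mul, Pi.mul_apply] at this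
    simp only [Subalgebra.coe_mul] at hsy
    rw [← one_mul ((c k : M → ℂ) y)]
    rw [show (1 : ℂ) = (s : M → ℂ) y * (A.det : M → ℂ) y from hsy.symm]
    exact this
  have hqB : ∀ m, ((Matrix.vecMul q B m : smoothFun N M) : M → ℂ) y
      = ∑ l, (q l : M → ℂ) y * (b l m : M → ℂ) y := by
    intro m
    simp [Matrix.vecMul, dotProduct, B]
  have hsum : ∑ l, (q l : M → ℂ) y * ((ψ l : M → ℂ) y - (ψ l : M → ℂ) p)
      = ∑ k, ((c k : M → ℂ) y * ((ζ k : M → ℂ) y - (ζ k : M → ℂ) p)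
        + ((Matrix.vecMul q B k : smoothFun N M) : M → ℂ) y
          * ((φ k : M → ℂ) y - (φ k : M → ℂ) p)) := by
    simp only [← hqy, hqB, Finset.sum_mul, ← Finset.sum_add_distrib]
    rw [Finset.sum_comm]
    refine Finset.sum_congr rfl fun l _ => ?_
    rw [hψ l, add_sub_cancel_left, Finset.mul_sum]
    exact Finset.sum_congr rfl fun k _ => by ring
  rw [hy, Finset.sum_add_distrib, Finset.sum_add_distrib, hsum, Finset.sum_add_distrib]
  simp only [Pi.sub_apply, AddSubgroupClass.coe_sub, sub_mul, Finset.sum_sub_distrib]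
  ring

/-! ### Formal operators commuting with `ψ_l + ħ δ_l` -/

/-- The formal operator `∑ ħ^n T_n` is local and commutes on `V` with the multiplications by the
`φ_l` and with the operators `ψ_l + ħ δ_l`. -/
structure IntertwinesOn (V : Set M) (φ ψ : Fin N → smoothFun N M)
    (δ : Fin N → Derivation ℂ (smoothFun N M) (smoothFun N M))
    (T : ℕ → smoothFun N M →ₗ[ℂ] smoothFun N M) : Prop where
  isLocalOn : ∀ n, IsLocalOn V (T n)
  mul_left : ∀ n l f, ∀ y ∈ V, (T n (φ l * f) : M → ℂ) y = (φ l : M → ℂ) y * (T n f : M → ℂ) y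
  zero : ∀ l f, ∀ y ∈ V, (T 0 (ψ l * f) : M → ℂ) y = (ψ l : M → ℂ) y * (T 0 f : M → ℂ) y
  succ : ∀ n l f, ∀ y ∈ V, (T (n + 1) (ψ l * f) : M → ℂ) y + (T n (δ l f) : M → ℂ) y
    = (ψ l : M → ℂ) y * (T (n + 1) f : M → ℂ) y + (δ l (T n f) : M → ℂ) y

variable {δ : Fin N → Derivation ℂ (smoothFun N M) (smoothFun N M)}
  {S S' : ℕ → smoothFun N M →ₗ[ℂ] smoothFun N M}

lemma IntertwinesOn.sub (h : IntertwinesOn V φ ψ δ S) (h' : IntertwinesOn V φ ψ δ S') :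
    IntertwinesOn V φ ψ δ (S - S') where
  isLocalOn n := (h.isLocalOn n).sub (h'.isLocalOn n)
  mul_left n l f y hy := by simp [h.mul_left n l f y hy, h'.mul_left n l f y hy, mul_sub]
  zero l f y hy := by simp [h.zero l f y hy, h'.zero l f y hy, mul_sub]
  succ n l f y hy := by
    have h1 := h.succ n l f y hy
    have h2 := h'.succ n l f y hy
    simp only [Pi.sub_apply, LinearMap.sub_apply, map_sub, AddSubgroupClass.coe_sub]
    linear_combination h1 - h2

/-- Such a formal operator is determined by its value on `1`. -/
lemma IntertwinesOn.eqOn [T2Space M] [IsManifold 𝓘(ℂ, Cn N) ω M] (hV : IsOpen V)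
    (hH : HadamardOn V φ ψ) (h : IntertwinesOn V φ ψ δ S) (h' : IntertwinesOn V φ ψ δ S')
    (h1 : ∀ n, Set.EqOn (S n 1 : M → ℂ) (S' n 1) V) (n : ℕ) (f : smoothFun N M) :
    Set.EqOn (S n f : M → ℂ) (S' n f) V := by
  have hs := h.sub h'
  suffices ∀ n f, ∀ y ∈ V, ((S - S') n f : M → ℂ) y = 0 from fun y hy => by
    simpa [sub_eq_zero] using this n f y hy
  have h1' : ∀ n, ∀ y ∈ V, ((S - S') n 1 : M → ℂ) y = 0 := fun n y hy => by
    simp [h1 n hy]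
  -- Once the difference vanishes at order `n` on every function, both `δ`-terms drop out of the
  -- relation at order `n + 1`, whose coefficient then commutes with `ψ`.
  intro n
  induction n with
  | zero => exact hH.eq_zero (hs.isLocalOn 0) (hs.mul_left 0) hs.zero (h1' 0)
  | succ n ih =>
    refine hH.eq_zero (hs.isLocalOn _) (hs.mul_left _) (fun l f y hy => ?_) (h1' _)
    have hd : (δ l ((S - S') n f) : M → ℂ) y = 0 := by
      rw [derivation_congr_on (δ l) hV (g := 0) (fun z hz => ih f z hz) hy]
      simp
    have := hs.succ n l f y hy
    rwa [ih _ y hy, hd, add_zero, add_zero] at this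

/-- The formal operator `p + ħ X` for formal series of functions `p` and of derivations `X`. -/
def firstOrderOp (p : ℕ → smoothFun N M)
    (X : ℕ → Derivation ℂ (smoothFun N M) (smoothFun N M)) :
    ℕ → smoothFun N M →ₗ[ℂ] smoothFun N M
  | 0 => LinearMap.mulLeft ℂ (p 0)
  | n + 1 => LinearMap.mulLeft ℂ (p (n + 1)) + (X n : smoothFun N M →ₗ[ℂ] smoothFun N M)

/-- The hypotheses are the vanishing of the terms in `[p + ħ X, φ] = ħ X φ` and `[p + ħ X, ψ + ħ δ]
= ħ (X ψ - δ p) + ħ² [X, δ]`. -/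
lemma intertwinesOn_firstOrderOp [T2Space M] [IsManifold 𝓘(ℂ, Cn N) ω M]
    {p : ℕ → smoothFun N M} {X : ℕ → Derivation ℂ (smoothFun N M) (smoothFun N M)}
    (hφ : ∀ n l, ∀ y ∈ V, (X n (φ l) : M → ℂ) y = 0)
    (hψ : ∀ n l, ∀ y ∈ V, (X n (ψ l) : M → ℂ) y = (δ l (p n) : M → ℂ) y)
    (hδ : ∀ n l f, ∀ y ∈ V, (X n (δ l f) : M → ℂ) y = (δ l (X n f) : M → ℂ) y) :
    IntertwinesOn V φ ψ δ (firstOrderOp p X) where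
  isLocalOn n := by
    cases n with
    | zero => exact isLocalOn_mulLeft _
    | succ n => exact (isLocalOn_mulLeft _).add (isLocalOn_derivation _)
  mul_left n l f y hy := by
    cases n with
    | zero => simp [firstOrderOp]; ring
    | succ n => simp [firstOrderOp, hφ n l y hy]; ring
  zero l f y hy := by simp [firstOrderOp]; ring
  succ n l f y hy := by
    cases n with
    | zero => simp [firstOrderOp, hψ 0 l y hy]; ring
    | succ n => simp [firstOrderOp, hψ (n + 1) l y hy, hδ n l f y hy]; ring

/-- If `S` commutes with `ψ_l + ħ δ_l`, `S'` commutes with `ζ`, and `S - S' = ħ Y` for a formal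
vector field `Y`, then the functions `Y_n ζ` are killed by the `δ_l`. -/
lemma IntertwinesOn.deriv_apply_eq_zero [T2Space M] [IsManifold 𝓘(ℂ, Cn N) ω M] (hV : IsOpen V)
    (h : IntertwinesOn V φ ψ δ S) {ζ : smoothFun N M}
    {Y : ℕ → Derivation ℂ (smoothFun N M) (smoothFun N M)}
    (hS' : ∀ n f, ∀ y ∈ V, (S' n (ζ * f) : M → ℂ) y = (ζ : M → ℂ) y * (S' n f : M → ℂ) y)
    (hζ : ∀ l, ∀ y ∈ V, (δ l ζ : M → ℂ) y = 0)
    (hY : ∀ n f, ∀ y ∈ V, (S (n + 1) f : M → ℂ) y = (S' (n + 1) f : M → ℂ) y + (Y n f : M → ℂ) y)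
    (n : ℕ) (l : Fin N) :
    ∀ y ∈ V, (δ l (Y n ζ) : M → ℂ) y = 0 := by
  -- Put `P = S 1 = S' 1 + ħ Y 1`, where `Y 1 = 0`. Then `S ζ = ζ P + ħ Y ζ`, and since `S'`
  -- commutes with `ζ`, also `S (ψ ζ) = ζ S ψ + ħ ψ Y ζ` with `S ψ = ψ P + ħ δ P`. Comparing with `S
  -- (ψ ζ) = (ψ + ħ δ) (S ζ)`, everything cancels except `ħ² δ (Y ζ)`.
  have hSζ : ∀ n, ∀ y ∈ V, (S (n + 1) ζ : M → ℂ) y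
      = (ζ : M → ℂ) y * (S (n + 1) 1 : M → ℂ) y + (Y n ζ : M → ℂ) y := fun n y hy => by
    have h1 := hS' (n + 1) 1 y hy
    have h2 := hY n 1 y hy
    rw [mul_one] at h1
    simp only [Derivation.map_one_eq_zero, ZeroMemClass.coe_zero, Pi.zero_apply, add_zero] at h2
    rw [hY n ζ y hy, h1, h2]
  intro y hy
  -- The surviving term `ħ² δ (Y_n ζ)` sits at order `n + 2`, hence the relation with index `n + 1`.
  have e1 := h.succ (n + 1) l ζ y hy
  have e2 : (S (n + 1) (δ l ζ) : M → ℂ) y = 0 := by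
    rw [(h.isLocalOn (n + 1)).congr_of_eqOn hV (g := 0) (fun z hz => hζ l z hz) hy]
    simp
  have e3 : (δ l (S (n + 1) ζ) : M → ℂ) y
      = (ζ : M → ℂ) y * (δ l (S (n + 1) 1) : M → ℂ) y + (δ l (Y n ζ) : M → ℂ) y := by
    rw [derivation_congr_on (δ l) hV (g := ζ * S (n + 1) 1 + Y n ζ)
      (fun z hz => by simpa using hSζ n z hz) hy]
    simp [hζ l y hy]
  have e4 := h.succ (n + 1) l 1 y hy
  simp only [mul_one, Derivation.map_one_eq_zero, map_zero, ZeroMemClass.coe_zero, Pi.zero_apply,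
    add_zero] at e4
  have e5 := hY (n + 1) (ψ l * ζ) y hy
  have e6 := hY (n + 1) (ψ l) y hy
  have e7 := hS' (n + 1 + 1) (ψ l) y hy
  rw [mul_comm ζ (ψ l)] at e7
  have e8 : (Y (n + 1) (ψ l * ζ) : M → ℂ) y = (ψ l : M → ℂ) y * (Y (n + 1) ζ : M → ℂ) y
      + (ζ : M → ℂ) y * (Y (n + 1) (ψ l) : M → ℂ) y := by simp
  have e9 := hSζ (n + 1) y hy
  rw [e2, e3] at e1
  linear_combination (-1 : ℂ) * e1 + e5 + e7 + e8 - (ζ : M → ℂ) y * e6 + (ζ : M → ℂ) y * e4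
    - (ψ l : M → ℂ) y * e9

end

section

variable {N : ℕ} {M : Type*} [TopologicalSpace M] [ChartedSpace (Cn N) M]

/-! ### Left and right star multiplication -/

lemma coeff_coe (F : Formal N M) (n : ℕ) :
    PowerSeries.coeff n F.coe = (PowerSeries.coeff n F : smoothFun N M) := by
  simp [Formal.coe]

/-- The coefficient of `ħ^n` in the operator `f ↦ P * f`. -/
def leftOp (C : ℕ → smoothFun N M →ₗ[ℂ] smoothFun N M →ₗ[ℂ] smoothFun N M) (P : Formal N M)
    (n : ℕ) : smoothFun N M →ₗ[ℂ] smoothFun N M :=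
  ∑ p ∈ antidiagonal n, C p.1 (PowerSeries.coeff p.2 P)

/-- The coefficient of `ħ^n` in the operator `f ↦ f * P`. -/
def rightOp (C : ℕ → smoothFun N M →ₗ[ℂ] smoothFun N M →ₗ[ℂ] smoothFun N M) (P : Formal N M)
    (n : ℕ) : smoothFun N M →ₗ[ℂ] smoothFun N M :=
  ∑ p ∈ antidiagonal n, (C p.1).flip (PowerSeries.coeff p.2 P)

variable (C : ℕ → smoothFun N M →ₗ[ℂ] smoothFun N M →ₗ[ℂ] smoothFun N M)

/-- The triple sum over the orders of `C`, `F` and `G` is regrouped by the order of `G`, which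
exhibits the product as the formal operator `L_F` applied to `G`. -/
lemma coeff_starProd_left (F G : Formal N M) (n : ℕ) :
    PowerSeries.coeff n (starProd C F G)
      = ∑ p ∈ antidiagonal n, leftOp C F p.1 (PowerSeries.coeff p.2 G) := by
  simp only [starProd, PowerSeries.coeff_mk, leftOp, LinearMap.sum_apply]
  rw [Finset.sum_sigma', Finset.sum_sigma']
  refine Finset.sum_nbij' (fun a => ⟨(a.1.1 + a.2.1, a.2.2), (a.1.1, a.2.1)⟩)
    (fun b => ⟨(b.2.1, b.2.2 + b.1.2), (b.2.2, b.1.2)⟩) ?_ ?_ ?_ ?_ ?_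
  all_goals
    rintro ⟨⟨a, b⟩, ⟨c, d⟩⟩ h
    simp only [Finset.mem_sigma, HasAntidiagonal.mem_antidiagonal] at h ⊢
    try obtain ⟨rfl, rfl⟩ := h
  · simp [add_assoc]
  · simp [add_assoc]
  · rfl
  · rfl

lemma coeff_starProd_right (F G : Formal N M) (n : ℕ) :
    PowerSeries.coeff n (starProd C F G)
      = ∑ p ∈ antidiagonal n, rightOp C G p.1 (PowerSeries.coeff p.2 F) := by
  simp only [starProd, PowerSeries.coeff_mk, rightOp, LinearMap.sum_apply, LinearMap.flip_apply]
  rw [Finset.sum_sigma', Finset.sum_sigma']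
  refine Finset.sum_nbij' (fun a => ⟨(a.1.1 + a.2.2, a.2.1), (a.1.1, a.2.2)⟩)
    (fun b => ⟨(b.2.1, b.1.2 + b.2.2), (b.1.2, b.2.2)⟩) ?_ ?_ ?_ ?_ ?_
  all_goals
    rintro ⟨⟨a, b⟩, ⟨c, d⟩⟩ h
    simp only [Finset.mem_sigma, HasAntidiagonal.mem_antidiagonal] at h ⊢
    try obtain ⟨rfl, rfl⟩ := h
  · exact ⟨by ring, trivial⟩
  · exact ⟨by ring, trivial⟩
  · rfl
  · rfl

lemma sum_antidiagonal_eq_single {A : Type*} [AddCommMonoid A] (F : ℕ → ℕ → A)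
    (hF : ∀ i j, F i (j + 1) = 0) (n : ℕ) : ∑ p ∈ antidiagonal n, F p.1 p.2 = F n 0 := by
  refine Finset.sum_eq_single (n, 0) (fun p hp hne => ?_) (fun h => by simp at h)
  obtain ⟨i, _ | j⟩ := p
  · simp only [HasAntidiagonal.mem_antidiagonal, add_zero] at hp
    exact absurd (by rw [hp]) hne
  · exact hF i j

lemma sum_antidiagonal_eq_pair {A : Type*} [AddCommMonoid A] (F : ℕ → ℕ → A)
    (hF : ∀ i j, F i (j + 2) = 0) (n : ℕ) :
    ∑ p ∈ antidiagonal (n + 1), F p.1 p.2 = F (n + 1) 0 + F n 1 := by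
  rw [Finset.Nat.sum_antidiagonal_succ']
  rw [sum_antidiagonal_eq_single (fun i j => F i (j + 1)) hF n]

lemma coeff_starProd_C_right (P : Formal N M) (f : smoothFun N M) (n : ℕ) :
    PowerSeries.coeff n (starProd C P (PowerSeries.C f)) = leftOp C P n f := by
  rw [coeff_starProd_left,
    sum_antidiagonal_eq_single fun i j => leftOp C P i (PowerSeries.coeff j (PowerSeries.C f))]
  · simp
  · intro i j
    simp

lemma coeff_starProd_C_left (P : Formal N M) (f : smoothFun N M) (n : ℕ) :
    PowerSeries.coeff n (starProd C (PowerSeries.C f) P) = rightOp C P n f := by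
  rw [coeff_starProd_right,
    sum_antidiagonal_eq_single fun i j => rightOp C P i (PowerSeries.coeff j (PowerSeries.C f))]
  · simp
  · intro i j
    simp

lemma leftOp_C (a : smoothFun N M) (n : ℕ) : leftOp C (PowerSeries.C a) n = C n a := by
  rw [leftOp, sum_antidiagonal_eq_single fun i j => C i (PowerSeries.coeff j (PowerSeries.C a))]
  · simp
  · intro i j
    simp

lemma rightOp_C (a : smoothFun N M) (n : ℕ) : rightOp C (PowerSeries.C a) n = (C n).flip a := by
  rw [rightOp,
    sum_antidiagonal_eq_single fun i j => (C i).flip (PowerSeries.coeff j (PowerSeries.C a))]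
  · simp
  · intro i j
    simp

variable {C}

/-! ### Locality -/

variable {e : OpenPartialHomeomorph M (Cn N)} {x : M}

lemma iterD_congr (hx : x ∈ e.source) {f g : M → ℂ} (h : f =ᶠ[𝓝 x] g) :
    ∀ w, iterD e w f =ᶠ[𝓝 x] iterD e w g
  | [] => h
  | Sum.inl k :: w => by
    simp only [iterD, dz_eq_chartDeriv]
    exact chartDeriv_congr hx (iterD_congr hx h w)
  | Sum.inr k :: w => by
    simp only [iterD, dzbar_eq_chartDeriv]
    exact chartDeriv_congr hx (iterD_congr hx h w)

section

variable [IsManifold 𝓘(ℂ, Cn N) ω M] {V : Set M}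
  {B : smoothFun N M →ₗ[ℂ] smoothFun N M →ₗ[ℂ] smoothFun N M}

lemma IsBidifferential.congr (hB : IsBidifferential B) {f f' g g' : smoothFun N M} {y : M}
    (hf : (f : M → ℂ) =ᶠ[𝓝 y] f') (hg : (g : M → ℂ) =ᶠ[𝓝 y] g') :
    (B f g : M → ℂ) y = (B f' g' : M → ℂ) y := by
  obtain ⟨U, -, hyU, -, S, c, -, h⟩ := hB (chartAt (Cn N) y)
    (IsManifold.chart_mem_maximalAtlas y) y (mem_chart_source _ y)
  rw [h f g y hyU, h f' g' y hyU]
  refine Finset.sum_congr rfl fun s _ => ?_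
  rw [(iterD_congr (mem_chart_source _ y) hf s.1).eq_of_nhds,
    (iterD_congr (mem_chart_source _ y) hg s.2).eq_of_nhds]

lemma IsBidifferential.isLocalOn (hB : IsBidifferential B) (f : smoothFun N M) :
    IsLocalOn V (B f) := fun g y _ hg => by
  rw [hB.congr (f' := f) (g' := 0) EventuallyEq.rfl hg, map_zero]
  rfl

lemma IsBidifferential.isLocalOn_flip (hB : IsBidifferential B) (g : smoothFun N M) :
    IsLocalOn V (B.flip g) := fun f y _ hf => by
  rw [LinearMap.flip_apply, hB.congr (f' := 0) (g' := g) hf EventuallyEq.rfl, map_zero]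
  rfl

lemma isLocalOn_leftOp (hC : ∀ k, IsBidifferential (C k)) (P : Formal N M) (n : ℕ) :
    IsLocalOn V (leftOp C P n) :=
  IsLocalOn.sum _ fun p _ => (hC p.1).isLocalOn _

lemma isLocalOn_rightOp (hC : ∀ k, IsBidifferential (C k)) (P : Formal N M) (n : ℕ) :
    IsLocalOn V (rightOp C P n) :=
  IsLocalOn.sum _ fun p _ => (hC p.1).isLocalOn_flip _

end

/-- If the formal operators `T` and `E` commute and `E = b + ħ δ` on `V`, then `T` commutes with
`b + ħ δ` on `V`. -/
lemma comm_of_eq_firstOrder [T2Space M] [IsManifold 𝓘(ℂ, Cn N) ω M] {V : Set M} (hV : IsOpen V)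
    {T E : ℕ → smoothFun N M →ₗ[ℂ] smoothFun N M} (hT : ∀ n, IsLocalOn V (T n))
    {b : smoothFun N M} {δ : Derivation ℂ (smoothFun N M) (smoothFun N M)}
    (hE0 : ∀ f, ∀ y ∈ V, (E 0 f : M → ℂ) y = (b : M → ℂ) y * (f : M → ℂ) y)
    (hE1 : ∀ f, ∀ y ∈ V, (E 1 f : M → ℂ) y = (δ f : M → ℂ) y)
    (hE2 : ∀ k f, ∀ y ∈ V, (E (k + 2) f : M → ℂ) y = 0)
    (hTE : ∀ n f, ∑ p ∈ antidiagonal n, T p.1 (E p.2 f)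
      = ∑ p ∈ antidiagonal n, E p.1 (T p.2 f)) :
    (∀ f, ∀ y ∈ V, (T 0 (b * f) : M → ℂ) y = (b : M → ℂ) y * (T 0 f : M → ℂ) y) ∧
    ∀ n f, ∀ y ∈ V, (T (n + 1) (b * f) : M → ℂ) y + (T n (δ f) : M → ℂ) y
      = (b : M → ℂ) y * (T (n + 1) f : M → ℂ) y + (δ (T n f) : M → ℂ) y := by
  -- `E` has the prescribed form only on `V`; locality of `T` permits the substitution under `T`.
  have hT0 : ∀ n f, ∀ y ∈ V, (T n (E 0 f) : M → ℂ) y = (T n (b * f) : M → ℂ) y :=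
    fun n f y hy => (hT n).congr_of_eqOn hV (fun z hz => by simp [hE0 f z hz]) hy
  have hT1 : ∀ n f, ∀ y ∈ V, (T n (E 1 f) : M → ℂ) y = (T n (δ f) : M → ℂ) y :=
    fun n f y hy => (hT n).congr_of_eqOn hV (fun z hz => hE1 f z hz) hy
  have hT2 : ∀ n k f, ∀ y ∈ V, (T n (E (k + 2) f) : M → ℂ) y = 0 := fun n k f y hy => by
    rw [(hT n).congr_of_eqOn hV (g := 0) (fun z hz => hE2 k f z hz) hy, map_zero]; rfl
  refine ⟨fun f y hy => ?_, fun n f y hy => ?_⟩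
  · have h := congrArg (fun g : smoothFun N M => (g : M → ℂ) y) (hTE 0 f)
    simp only [Finset.Nat.antidiagonal_zero, Finset.sum_singleton] at h
    rw [← hT0 0 f y hy, h, hE0 _ y hy]
  · have h := congrArg (fun g : smoothFun N M => (g : M → ℂ) y) (hTE (n + 1) f)
    simp only [AddSubmonoidClass.coe_finsetSum, Finset.sum_apply] at h
    rw [sum_antidiagonal_eq_pair (fun i j => (T i (E j f) : M → ℂ) y)
        (fun i j => hT2 i j f y hy),
      ← Finset.Nat.sum_antidiagonal_swap] at h
    simp only [Prod.fst_swap, Prod.snd_swap] at h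
    rw [sum_antidiagonal_eq_pair (fun i j => (E j (T i f) : M → ℂ) y)
        (fun i j => hE2 j _ y hy), hT0 _ _ y hy, hT1 _ _ y hy, hE0 _ y hy, hE1 _ y hy] at h
    exact h

/-! ### The star product: consequences of the axioms -/

namespace StarProduct

variable {K : KahlerMetric N M} (S : StarProduct K)

lemma leftOp_one (P : Formal N M) (n : ℕ) : leftOp S.C P n 1 = PowerSeries.coeff n P := by
  rw [← coeff_starProd_C_right, map_one, S.mul_one]

lemma rightOp_one (P : Formal N M) (n : ℕ) : rightOp S.C P n 1 = PowerSeries.coeff n P := by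
  rw [← coeff_starProd_C_left, map_one, S.one_mul]

lemma leftOp_zero (P : Formal N M) (f : smoothFun N M) :
    leftOp S.C P 0 f = PowerSeries.coeff 0 P * f := by
  simp [leftOp, S.C_zero]

lemma rightOp_zero (P : Formal N M) (f : smoothFun N M) :
    rightOp S.C P 0 f = f * PowerSeries.coeff 0 P := by
  simp [rightOp, S.C_zero]

/-- Associativity `(P * f) * b = P * (f * b)`: left and right multiplications commute. -/
lemma leftOp_comm_C_flip (P : Formal N M) (b f : smoothFun N M) (n : ℕ) :
    ∑ p ∈ antidiagonal n, leftOp S.C P p.1 ((S.C p.2).flip b f)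
      = ∑ p ∈ antidiagonal n, (S.C p.1).flip b (leftOp S.C P p.2 f) := by
  have h := congrArg (PowerSeries.coeff n) (S.assoc P (PowerSeries.C f) (PowerSeries.C b))
  rw [coeff_starProd_right, coeff_starProd_left] at h
  simp only [coeff_starProd_C_right, rightOp_C, leftOp_C] at h
  exact h.symm

lemma rightOp_comm_C (P : Formal N M) (a f : smoothFun N M) (n : ℕ) :
    ∑ p ∈ antidiagonal n, rightOp S.C P p.1 (S.C p.2 a f)
      = ∑ p ∈ antidiagonal n, S.C p.1 a (rightOp S.C P p.2 f) := by
  have h := congrArg (PowerSeries.coeff n) (S.assoc (PowerSeries.C a) (PowerSeries.C f) P)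
  rw [coeff_starProd_right, coeff_starProd_left] at h
  simp only [coeff_starProd_C_left, rightOp_C, leftOp_C, LinearMap.flip_apply] at h
  exact h

variable {S}

lemma SeparatesVariables.C_of_hol (hsep : S.SeparatesVariables) {V : Set M} (hV : IsOpen V)
    {a : smoothFun N M} (ha : MDifferentiableOn 𝓘(ℂ, Cn N) 𝓘(ℂ, ℂ) (a : M → ℂ) V)
    (k : ℕ) (f : smoothFun N M) : ∀ y ∈ V, (S.C (k + 1) a f : M → ℂ) y = 0 := fun y hy => by
  have h := hsep.1 V a f hV ha (k + 1) y hy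
  simp only [coeff_coe, coeff_starProd_C_right, leftOp_C] at h
  simpa [PowerSeries.coeff_C] using h

lemma SeparatesVariables.C_of_antihol (hsep : S.SeparatesVariables) {V : Set M} (hV : IsOpen V)
    {b : smoothFun N M} (hb : MDifferentiableOn 𝓘(ℂ, Cn N) 𝓘(ℂ, ℂ)
      (fun x => (starRingEnd ℂ) ((b : M → ℂ) x)) V)
    (k : ℕ) (f : smoothFun N M) : ∀ y ∈ V, (S.C (k + 1) f b : M → ℂ) y = 0 := fun y hy => by
  have h := hsep.2 V b f hV hb (k + 1) y hy
  simp only [coeff_coe, coeff_starProd_C_right, leftOp_C] at h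
  simpa [PowerSeries.coeff_C] using h

/-- `P * ·` commutes with multiplication by antiholomorphic functions. -/
lemma SeparatesVariables.leftOp_mul [T2Space M] [IsManifold 𝓘(ℂ, Cn N) ω M]
    (hsep : S.SeparatesVariables) {V : Set M} (hV : IsOpen V)
    {b : smoothFun N M} (hb : MDifferentiableOn 𝓘(ℂ, Cn N) 𝓘(ℂ, ℂ)
      (fun x => (starRingEnd ℂ) ((b : M → ℂ) x)) V) (P : Formal N M) (n : ℕ) (f : smoothFun N M) :
    ∀ y ∈ V, (leftOp S.C P n (b * f) : M → ℂ) y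
      = (b : M → ℂ) y * (leftOp S.C P n f : M → ℂ) y := fun y hy => by
  -- On `V` right star multiplication by `b` is the ordinary one, the case `δ = 0` of a first-order
  -- operator.
  have h := comm_of_eq_firstOrder hV (T := leftOp S.C P) (E := fun k => (S.C k).flip b) (b := b)
    (δ := 0) (isLocalOn_leftOp S.bidifferential P)
    (fun f y _ => by simp [S.C_zero, mul_comm])
    (fun f y hy => by simpa using hsep.C_of_antihol hV hb 0 f y hy)
    (fun k f y hy => by simpa using hsep.C_of_antihol hV hb (k + 1) f y hy)
    (fun n f => S.leftOp_comm_C_flip P b f n)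
  cases n with
  | zero => exact h.1 f y hy
  | succ n => simpa using h.2 n f y hy

/-- `· * P` commutes with multiplication by holomorphic functions. -/
lemma SeparatesVariables.rightOp_mul [T2Space M] [IsManifold 𝓘(ℂ, Cn N) ω M]
    (hsep : S.SeparatesVariables) {V : Set M} (hV : IsOpen V)
    {a : smoothFun N M} (ha : MDifferentiableOn 𝓘(ℂ, Cn N) 𝓘(ℂ, ℂ) (a : M → ℂ) V)
    (P : Formal N M) (n : ℕ) (f : smoothFun N M) :
    ∀ y ∈ V, (rightOp S.C P n (a * f) : M → ℂ) y
      = (a : M → ℂ) y * (rightOp S.C P n f : M → ℂ) y := fun y hy => by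
  have h := comm_of_eq_firstOrder hV (T := rightOp S.C P) (E := fun k => S.C k a) (b := a)
    (δ := 0) (isLocalOn_rightOp S.bidifferential P)
    (fun f y _ => by simp [S.C_zero])
    (fun f y hy => by simpa using hsep.C_of_hol hV ha 0 f y hy)
    (fun k f y hy => by simpa using hsep.C_of_hol hV ha (k + 1) f y hy)
    (fun n f => S.rightOp_comm_C P a f n)
  cases n with
  | zero => exact h.1 f y hy
  | succ n => simpa using h.2 n f y hy

/-- Karabegov's condition, order by order in `ħ`. -/
lemma KarabegovCondition.leftOp_comm (hKar : S.KarabegovCondition) {V : Set M} (hV : IsOpen V)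
    {Φ : M → ℝ} (hΦ : K.IsPotentialOn V Φ) (he : e ∈ holCharts N M) (hVe : V ⊆ e.source)
    {l : Fin N} {w : smoothFun N M} {δ : Derivation ℂ (smoothFun N M) (smoothFun N M)}
    (hw : ∀ y ∈ V, (w : M → ℂ) y = dzbar e l (fun x => (Φ x : ℂ)) y)
    (hδ : ∀ f : smoothFun N M, ∀ y ∈ V, (δ f : M → ℂ) y = dzbar e l f y) (P : Formal N M)
    (f : smoothFun N M) :
    (∀ y ∈ V, (leftOp S.C P 0 (w * f) : M → ℂ) y
      = (w : M → ℂ) y * (leftOp S.C P 0 f : M → ℂ) y) ∧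
    ∀ n, ∀ y ∈ V, (leftOp S.C P (n + 1) (w * f) : M → ℂ) y + (leftOp S.C P n (δ f) : M → ℂ) y
      = (w : M → ℂ) y * (leftOp S.C P (n + 1) f : M → ℂ) y
        + (δ (leftOp S.C P n f) : M → ℂ) y := by
  -- A global formal function that agrees on `V` with `(∂_{l̄}Φ + ħ ∂_{l̄}) f`, as Karabegov's
  -- condition requires.
  set u : Formal N M := PowerSeries.C (w * f) + PowerSeries.X * PowerSeries.C (δ f) with hu
  have hu0 : PowerSeries.coeff 0 u = w * f := by simp [hu]
  have hu1 : PowerSeries.coeff 1 u = δ f := by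
    rw [hu, map_add, show (1 : ℕ) = 0 + 1 from rfl, PowerSeries.coeff_succ_X_mul]
    simp [PowerSeries.coeff_C]
  have hu2 : ∀ n, PowerSeries.coeff (n + 2) u = 0 := fun n => by
    rw [hu, map_add, PowerSeries.coeff_succ_X_mul]
    simp
  have hz : ∀ y, dzbar e l (0 : M → ℂ) y = 0 := fun y => chartDeriv_const 0
  have hop0 : ∀ (G : Formal N M), ∀ y ∈ V, PowerSeries.coeff 0 (potentialOp e l Φ G.coe) y
      = (w : M → ℂ) y * ((PowerSeries.coeff 0 G : smoothFun N M) : M → ℂ) y := fun G y hy => by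
    rw [potentialOp, map_add, PowerSeries.coeff_C_mul, PowerSeries.coeff_zero_X_mul, add_zero,
      coeff_coe, Pi.mul_apply, hw y hy]
  have hop : ∀ (G : Formal N M) (n : ℕ), ∀ y ∈ V,
      PowerSeries.coeff (n + 1) (potentialOp e l Φ G.coe) y
        = (w : M → ℂ) y * ((PowerSeries.coeff (n + 1) G : smoothFun N M) : M → ℂ) y
          + dzbar e l (PowerSeries.coeff n G : smoothFun N M) y := fun G n y hy => by
    rw [potentialOp, map_add, PowerSeries.coeff_C_mul, PowerSeries.coeff_succ_X_mul,
      PowerSeries.coeff_mk, coeff_coe, coeff_coe, Pi.add_apply, Pi.mul_apply, hw y hy]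
  have key := hKar V Φ hV hΦ e he l P (PowerSeries.C f) u (by
    rintro (_ | _ | n) y ⟨hy, -⟩
    · rw [hop0 _ y hy, coeff_coe, hu0]
      simp
    · rw [hop _ _ y hy, coeff_coe, hu1, hδ f y hy]
      simp [PowerSeries.coeff_C]
    · rw [hop _ _ y hy, coeff_coe, hu2]
      simp [hz])
  refine ⟨fun y hy => ?_, fun n y hy => ?_⟩
  · have h := key 0 y ⟨hy, hVe hy⟩
    rw [hop0 _ y hy, coeff_coe, coeff_starProd_C_right, coeff_starProd_left] at h
    simpa [hu0] using h
  · have h := key (n + 1) y ⟨hy, hVe hy⟩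
    rw [hop _ _ y hy, coeff_coe, coeff_starProd_C_right, coeff_starProd_C_right,
      coeff_starProd_left,
      sum_antidiagonal_eq_pair (fun i j => leftOp S.C P i (PowerSeries.coeff j u))
        (fun i j => by simp [hu2]), hu0, hu1, ← hδ _ y hy] at h
    exact h

end StarProduct

end

section

variable {N : ℕ} {M : Type*} [TopologicalSpace M] [ChartedSpace (Cn N) M]
  {K : KahlerMetric N M} {e : OpenPartialHomeomorph M (Cn N)}

/-! ### The metric in coordinates -/

lemma mdifferentiable_of_mem_holCharts [IsManifold 𝓘(ℂ, Cn N) ω M] (he : e ∈ holCharts N M) :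
    e.MDifferentiable 𝓘(ℂ, Cn N) 𝓘(ℂ, Cn N) :=
  ⟨(contMDiffOn_of_mem_maximalAtlas he).mdifferentiableOn (by simp),
    (contMDiffOn_symm_of_mem_maximalAtlas he).mdifferentiableOn (by simp)⟩

/-- A left null vector `c` of the matrix gives the tangent vector `L c` with `h(L c, L c) = 0`.
Positivity forces `L c = 0`, and then `c = 0` because the differential of the inverse chart is
injective. -/
lemma det_gMat_ne_zero [IsManifold 𝓘(ℂ, Cn N) ω M] (h : HermitianForm N M)
    (he : e ∈ holCharts N M) {y : M} (hy : y ∈ e.source) : (h.gMat e y).det ≠ 0 := by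
  intro h0
  obtain ⟨c, hc, hcg⟩ := Matrix.exists_vecMul_eq_zero_iff.2 h0
  let L : Cn N →L[ℂ] TangentSpace 𝓘(ℂ, Cn N) (e.symm (e y)) :=
    mfderiv 𝓘(ℂ, Cn N) 𝓘(ℂ, Cn N) e.symm (e y)
  have hLc : L c = ∑ k, c k • L (Pi.single k 1) := by
    conv_lhs => rw [show c = ∑ k, c k • (Pi.single k 1 : Cn N) from by
      funext j; simp [Finset.sum_apply, Pi.single_apply]]
    simp only [map_sum, map_smul]
  have h1 : ∀ l, h.toFun (e.symm (e y)) (L c) (L (Pi.single l 1)) = 0 := by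
    intro l
    have := congrFun hcg l
    rw [hLc, map_sum, LinearMap.sum_apply]
    simp only [map_smul, LinearMap.smul_apply]
    exact this
  have h2 : h.toFun (e.symm (e y)) (L c) (L c) = 0 := by
    conv_lhs => arg 2; rw [hLc]
    simp [h1]
  have h3 : L c = 0 := by
    by_contra hne
    have := h.pos (e.symm (e y)) (L c) hne
    rw [h2] at this
    simp at this
  have h4 := (mdifferentiable_of_mem_holCharts he).comp_symm_deriv (e.map_source hy)
  have h5 := congrArg (fun A => A c) h4
  apply hc
  refine h5.symm.trans ?_
  change mfderiv 𝓘(ℂ, Cn N) 𝓘(ℂ, Cn N) e (e.symm (e y)) (L c) = 0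
  rw [h3, map_zero]

lemma HermitianForm.IsPotentialOn.mono {h : HermitianForm N M} {U V : Set M} {Φ : M → ℝ}
    (hΦ : h.IsPotentialOn U Φ) (hVU : V ⊆ U) : h.IsPotentialOn V Φ :=
  ⟨hΦ.1.mono hVU, fun e he y hy => hΦ.2 e he y ⟨hVU hy.1, hy.2⟩⟩

/-! ### Coordinate frames -/

/-- Globally defined smooth functions and derivations that restrict on an open subset `V` of the
coordinate domain to the coordinates, the coordinate derivations, the derivatives of a Kähler
potential and the inverse metric. -/
structure CoordFrame (K : KahlerMetric N M) (e : OpenPartialHomeomorph M (Cn N)) where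
  V : Set M
  isOpen : IsOpen V
  subset_source : V ⊆ e.source
  Φ : M → ℝ
  isPotentialOn : K.IsPotentialOn V Φ
  del : Fin N → Derivation ℂ (smoothFun N M) (smoothFun N M)
  delbar : Fin N → Derivation ℂ (smoothFun N M) (smoothFun N M)
  z : Fin N → smoothFun N M
  zbar : Fin N → smoothFun N M
  v : Fin N → smoothFun N M
  w : Fin N → smoothFun N M
  ginv : Matrix (Fin N) (Fin N) (smoothFun N M)
  del_apply : ∀ k f, ∀ y ∈ V, (del k f : M → ℂ) y = dz e k f y
  delbar_apply : ∀ k f, ∀ y ∈ V, (delbar k f : M → ℂ) y = dzbar e k f y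
  z_apply : ∀ k, ∀ y ∈ V, (z k : M → ℂ) y = e y k
  zbar_apply : ∀ k, ∀ y ∈ V, (zbar k : M → ℂ) y = (starRingEnd ℂ) (e y k)
  v_apply : ∀ k, ∀ y ∈ V, (v k : M → ℂ) y = dz e k (fun x => (Φ x : ℂ)) y
  w_apply : ∀ k, ∀ y ∈ V, (w k : M → ℂ) y = dzbar e k (fun x => (Φ x : ℂ)) y
  ginv_apply : ∀ i j, ∀ y ∈ V, (ginv i j : M → ℂ) y = (K.gMat e y)⁻¹ i j

lemma smoothAt_coord (he : e ∈ holCharts N M) (k : Fin N) {y : M} (hy : y ∈ e.source) :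
    SmoothAt N (fun y => e y k) y :=
  smoothAt_comp_chart (F := fun z => z k) (by fun_prop) he hy

lemma smoothAt_conj_coord (he : e ∈ holCharts N M) (k : Fin N) {y : M} (hy : y ∈ e.source) :
    SmoothAt N (fun y => (starRingEnd ℂ) (e y k)) y :=
  smoothAt_comp_chart (F := fun z => (starRingEnd ℂ) (z k))
    ((Complex.conjCLE : ℂ →L[ℝ] ℂ).contDiff.contDiffAt.comp _ (by fun_prop)) he hy

lemma exists_coordFrame [T2Space M] [IsManifold 𝓘(ℂ, Cn N) ω M] (K : KahlerMetric N M)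
    (he : e ∈ holCharts N M) {p : M} (hp : p ∈ e.source) :
    ∃ F : CoordFrame K e, p ∈ F.V := by
  obtain ⟨U, Φ, hU, hpU, hΦ⟩ := K.exists_potential p
  have hΦs : ∀ y ∈ U, SmoothAt N (fun x => (Φ x : ℂ)) y := fun y hy =>
    (Complex.ofRealCLM.contDiff.contMDiff (n := ∞)).contMDiffAt.comp y
      (hΦ.1.contMDiffAt (hU.mem_nhds hy))
  obtain ⟨χ, hχ, hχ1⟩ := exists_cutoff (N := N) ((hU.inter e.open_source).mem_nhds ⟨hpU, hp⟩)
  have hχe : tsupport (χ : M → ℂ) ⊆ e.source := fun y hy => (hχ hy).2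
  have hχU : ∀ y, (χ : M → ℂ) y = 1 → y ∈ U ∩ e.source := fun y hy =>
    hχ (subset_tsupport _ (by simp [hy]))
  let del := fun k => cutoffDeriv he χ hχe (-Complex.I) k
  let w : Fin N → smoothFun N M := fun k => cutoffMul χ (dzbar e k fun x => (Φ x : ℂ))
    fun y hy => (hΦs y (hχ hy).1).chartDeriv he (hχe hy)
  -- A matrix of global functions equal to `g_{k l̄}` at points near which `χ = 1`; this makes the
  -- entries of the metric smooth, and the adjugate with a local inverse of `det G` inverts it.
  let G : Matrix (Fin N) (Fin N) (smoothFun N M) := Matrix.of fun k l => del k (w l)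
  have hG : ∀ y, (∀ᶠ x in 𝓝 y, (χ : M → ℂ) x = 1) → ∀ k l,
      (G k l : M → ℂ) y = K.gMat e y k l := by
    intro y hy k l
    have hy1 : (χ : M → ℂ) y = 1 := hy.self_of_nhds
    rw [hΦ.2 e he y (hχU y hy1)]
    change (cutoffDeriv he χ hχe (-Complex.I) k (w l) : M → ℂ) y = _
    rw [cutoffDeriv_apply he χ hχe _ _ _ _ hy1, dz_eq_chartDeriv]
    refine (chartDeriv_congr (hχU y hy1).2 ?_).eq_of_nhds
    filter_upwards [hy] with x hx
    simp [w, cutoffMul, hx]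
  let ev : M → smoothFun N M →+* ℂ := fun y =>
    (Pi.evalRingHom (fun _ : M => ℂ) y).comp (smoothFun N M).val.toRingHom
  have hGev : ∀ y, (∀ᶠ x in 𝓝 y, (χ : M → ℂ) x = 1) → (ev y).mapMatrix G = K.gMat e y :=
    fun y hy => by ext k l; exact hG y hy k l
  have hdet : (G.det : M → ℂ) p ≠ 0 := by
    have h1 : (G.det : M → ℂ) p = ((ev p).mapMatrix G).det := RingHom.map_det (ev p) G
    rw [h1, hGev p hχ1]
    exact det_gMat_ne_zero _ he hp
  obtain ⟨s, hs⟩ := exists_inv_eventuallyEq G.det hdet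
  -- `V` is an open neighbourhood of `p` on which both `χ = 1` and `s · det G = 1`.
  obtain ⟨V, hVsub, hV, hpV⟩ := eventually_nhds_iff.1 (hχ1.and hs)
  have hVχ : ∀ y ∈ V, (χ : M → ℂ) y = 1 := fun y hy => (hVsub y hy).1
  refine ⟨{ V := V, isOpen := hV, subset_source := fun y hy => (hχU y (hVχ y hy)).2, Φ := Φ
            isPotentialOn := hΦ.mono fun y hy => (hχU y (hVχ y hy)).1
            del := del
            delbar := fun k => cutoffDeriv he χ hχe Complex.I k
            z := fun k => cutoffMul χ (fun y => e y k) fun y hy => smoothAt_coord he k (hχe hy)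
            zbar := fun k => cutoffMul χ (fun y => (starRingEnd ℂ) (e y k))
              fun y hy => smoothAt_conj_coord he k (hχe hy)
            v := fun k => cutoffMul χ (dz e k fun x => (Φ x : ℂ)) fun y hy => by
              rw [dz_eq_chartDeriv]; exact (hΦs y (hχ hy).1).chartDeriv he (hχe hy)
            w := w
            ginv := s • G.adjugate
            del_apply := fun k f y hy => by
              rw [dz_eq_chartDeriv]; exact cutoffDeriv_apply he χ hχe _ _ _ _ (hVχ y hy)
            delbar_apply := fun k f y hy => cutoffDeriv_apply he χ hχe _ _ _ _ (hVχ y hy)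
            z_apply := fun k y hy => by simp [cutoffMul, hVχ y hy]
            zbar_apply := fun k y hy => by simp [cutoffMul, hVχ y hy]
            v_apply := fun k y hy => by simp [cutoffMul, hVχ y hy]
            w_apply := fun k y hy => by simp [w, cutoffMul, hVχ y hy]
            ginv_apply := fun i j y hy => ?_ }, hpV⟩
  have hGy := hGev y ((hV.eventually_mem hy).mono hVχ)
  have hinv : (ev y).mapMatrix (s • G.adjugate) * K.gMat e y = 1 := by
    rw [← hGy, ← map_mul, Matrix.smul_mul, Matrix.adjugate_mul, smul_smul]
    ext i j
    have hsy : ev y (s * G.det) = 1 := (hVsub y hy).2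
    simp only [RingHom.mapMatrix_apply, Matrix.map_apply, Matrix.smul_apply, smul_eq_mul, map_mul]
    rw [← map_mul, hsy, one_mul, Matrix.one_apply, Matrix.one_apply]
    split_ifs <;> simp
  rw [Matrix.inv_eq_left_inv hinv]
  rfl

end

section

variable {N : ℕ} {M : Type*} [TopologicalSpace M] [ChartedSpace (Cn N) M]
  {K : KahlerMetric N M} {e : OpenPartialHomeomorph M (Cn N)}

namespace CoordFrame

variable (F : CoordFrame K e)

lemma del_eq_dz {f : smoothFun N M} {H : M → ℂ} (h : Set.EqOn (f : M → ℂ) H F.V) (k : Fin N) :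
    ∀ y ∈ F.V, (F.del k f : M → ℂ) y = chartDeriv e (-Complex.I) k H y := fun y hy => by
  rw [F.del_apply k f y hy, dz_eq_chartDeriv]
  exact (chartDeriv_congr (F.subset_source hy)
    (h.eventuallyEq_of_mem (F.isOpen.mem_nhds hy))).eq_of_nhds

lemma delbar_eq_dzbar {f : smoothFun N M} {H : M → ℂ} (h : Set.EqOn (f : M → ℂ) H F.V)
    (k : Fin N) :
    ∀ y ∈ F.V, (F.delbar k f : M → ℂ) y = chartDeriv e Complex.I k H y := fun y hy => by
  rw [F.delbar_apply k f y hy, dzbar_eq_chartDeriv]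
  exact (chartDeriv_congr (F.subset_source hy)
    (h.eventuallyEq_of_mem (F.isOpen.mem_nhds hy))).eq_of_nhds

lemma del_z (k j : Fin N) : ∀ y ∈ F.V, (F.del k (F.z j) : M → ℂ) y = if j = k then 1 else 0 :=
  fun y hy => by
  rw [F.del_eq_dz (H := (fun z : Cn N => z j) ∘ e) (fun x hx => F.z_apply j x hx) k y hy,
    chartDeriv_comp_chart (F.subset_source hy), wirtinger_coord]
  simp

lemma delbar_z (k j : Fin N) : ∀ y ∈ F.V, (F.delbar k (F.z j) : M → ℂ) y = 0 := fun y hy => by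
  rw [F.delbar_eq_dzbar (H := (fun z : Cn N => z j) ∘ e) (fun x hx => F.z_apply j x hx) k y hy,
    chartDeriv_comp_chart (F.subset_source hy), wirtinger_coord]
  simp

lemma del_zbar (k j : Fin N) : ∀ y ∈ F.V, (F.del k (F.zbar j) : M → ℂ) y = 0 := fun y hy => by
  rw [F.del_eq_dz (H := (fun z : Cn N => (starRingEnd ℂ) (z j)) ∘ e)
    (fun x hx => F.zbar_apply j x hx) k y hy,
    chartDeriv_comp_chart (F.subset_source hy), wirtinger_conj_coord]
  simp

lemma delbar_zbar (k j : Fin N) :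
    ∀ y ∈ F.V, (F.delbar k (F.zbar j) : M → ℂ) y = if j = k then 1 else 0 := fun y hy => by
  rw [F.delbar_eq_dzbar (H := (fun z : Cn N => (starRingEnd ℂ) (z j)) ∘ e)
    (fun x hx => F.zbar_apply j x hx) k y hy,
    chartDeriv_comp_chart (F.subset_source hy), wirtinger_conj_coord]
  simp

lemma smoothAt_potential {y : M} (hy : y ∈ F.V) : SmoothAt N (fun x => (F.Φ x : ℂ)) y :=
  (Complex.ofRealCLM.contDiff.contMDiff (n := ∞)).contMDiffAt.comp y
    (F.isPotentialOn.1.contMDiffAt (F.isOpen.mem_nhds hy))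

lemma del_w (he : e ∈ holCharts N M) (k l : Fin N) :
    ∀ y ∈ F.V, (F.del k (F.w l) : M → ℂ) y = K.gMat e y k l := fun y hy => by
  rw [F.isPotentialOn.2 e he y ⟨hy, F.subset_source hy⟩, dz_eq_chartDeriv]
  exact F.del_eq_dz (fun x hx => F.w_apply l x hx) k y hy

lemma delbar_v (he : e ∈ holCharts N M) (k l : Fin N) :
    ∀ y ∈ F.V, (F.delbar l (F.v k) : M → ℂ) y = K.gMat e y k l := fun y hy => by
  rw [F.isPotentialOn.2 e he y ⟨hy, F.subset_source hy⟩, dz_eq_chartDeriv, dzbar_eq_chartDeriv,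
    chartDeriv_comm he (F.subset_source hy) (F.smoothAt_potential hy)]
  refine F.delbar_eq_dzbar (fun x hx => ?_) l y hy
  rw [F.v_apply k x hx, dz_eq_chartDeriv]

lemma del_delbar (he : e ∈ holCharts N M) (k l : Fin N) (f : smoothFun N M) :
    ∀ y ∈ F.V, (F.del k (F.delbar l f) : M → ℂ) y = (F.delbar l (F.del k f) : M → ℂ) y :=
  fun y hy => by
  rw [F.del_eq_dz (fun x hx => F.delbar_apply l f x hx) k y hy,
    F.delbar_eq_dzbar (fun x hx => F.del_apply k f x hx) l y hy, dz_eq_chartDeriv,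
    dzbar_eq_chartDeriv, chartDeriv_comm he (F.subset_source hy) (smoothFun_smoothAt f y)]

lemma mdifferentiableOn_coord [IsManifold 𝓘(ℂ, Cn N) ω M] (he : e ∈ holCharts N M)
    (k : Fin N) : MDifferentiableOn 𝓘(ℂ, Cn N) 𝓘(ℂ, ℂ) (fun y => e y k) F.V := by
  have h : Differentiable ℂ (fun z : Cn N => z k) := by fun_prop
  exact h.mdifferentiable.comp_mdifferentiableOn
    ((mdifferentiable_of_mem_holCharts he).1.mono F.subset_source)

lemma mdifferentiableOn_z [IsManifold 𝓘(ℂ, Cn N) ω M] (he : e ∈ holCharts N M)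
    (k : Fin N) : MDifferentiableOn 𝓘(ℂ, Cn N) 𝓘(ℂ, ℂ) (F.z k : M → ℂ) F.V :=
  (F.mdifferentiableOn_coord he k).congr fun y hy => F.z_apply k y hy

lemma mdifferentiableOn_conj_zbar [IsManifold 𝓘(ℂ, Cn N) ω M] (he : e ∈ holCharts N M)
    (k : Fin N) : MDifferentiableOn 𝓘(ℂ, Cn N) 𝓘(ℂ, ℂ)
      (fun x => (starRingEnd ℂ) ((F.zbar k : M → ℂ) x)) F.V :=
  (F.mdifferentiableOn_coord he k).congr fun y hy => by simp [F.zbar_apply k y hy]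

section Hadamard

variable [T2Space M] [IsManifold 𝓘(ℂ, Cn N) ω M]

lemma hadamardOn_z_zbar (he : e ∈ holCharts N M) : HadamardOn F.V F.z F.zbar := by
  intro p hp f
  obtain ⟨a, b, hab⟩ := exists_hadamard_chart he (F.subset_source hp) f
  refine ⟨a, b, ?_⟩
  filter_upwards [hab, F.isOpen.mem_nhds hp] with y hy hyV
  simp only [F.z_apply _ _ hyV, F.z_apply _ _ hp, F.zbar_apply _ _ hyV, F.zbar_apply _ _ hp]
  exact hy

/-- In the change of coordinates from `(z, z̄)` to `(z̄, w)` the relevant Jacobian block is `∂_k w_l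
= g_{k l̄}`, which is nondegenerate. -/
lemma hadamardOn_zbar_w (he : e ∈ holCharts N M) : HadamardOn F.V F.zbar F.w := by
  refine (F.hadamardOn_z_zbar he).change F.del F.del_z F.del_zbar fun y hy => ?_
  have h : (Matrix.of fun l k => (F.del k (F.w l) : M → ℂ) y) = (K.gMat e y).transpose := by
    ext l k; exact F.del_w he k l y hy
  rw [h, Matrix.det_transpose]
  exact det_gMat_ne_zero _ he (F.subset_source hy)

lemma hadamardOn_z_v (he : e ∈ holCharts N M) : HadamardOn F.V F.z F.v := by
  refine (F.hadamardOn_z_zbar he).symm.change F.delbar F.delbar_zbar F.delbar_z fun y hy => ?_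
  have h : (Matrix.of fun l k => (F.delbar k (F.v l) : M → ℂ) y) = K.gMat e y := by
    ext l k; exact F.delbar_v he l k y hy
  rw [h]
  exact det_gMat_ne_zero _ he (F.subset_source hy)

end Hadamard

/-! ### Hamiltonian vector fields -/

/-- A global smooth function that restricts to `D^i f` on `V`. -/
def D (i : Fin N) (f : smoothFun N M) : smoothFun N M := ∑ j, F.ginv j i * F.delbar j f

/-- A global smooth function that restricts to `D^{ī} f` on `V`. -/
def Dbar (i : Fin N) (f : smoothFun N M) : smoothFun N M := ∑ j, F.ginv i j * F.del j f

lemma D_apply (i : Fin N) (f : smoothFun N M) :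
    ∀ y ∈ F.V, (F.D i f : M → ℂ) y = K.D e i f y := fun y hy => by
  simp [D, KahlerMetric.D, F.ginv_apply _ _ y hy, F.delbar_apply _ _ y hy]

lemma Dbar_apply (i : Fin N) (f : smoothFun N M) :
    ∀ y ∈ F.V, (F.Dbar i f : M → ℂ) y = K.Dbar e i f y := fun y hy => by
  simp [Dbar, KahlerMetric.Dbar, F.ginv_apply _ _ y hy, F.del_apply _ _ y hy]

lemma D_D_apply (i j : Fin N) (f : smoothFun N M) :
    ∀ y ∈ F.V, K.D e i (K.D e j f) y
      = ∑ l, (K.gMat e y)⁻¹ l i * (F.delbar l (F.D j f) : M → ℂ) y := fun y hy => by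
  simp only [KahlerMetric.D]
  refine Finset.sum_congr rfl fun l _ => ?_
  rw [F.delbar_eq_dzbar (fun x hx => F.D_apply j f x hx) l y hy, dzbar_eq_chartDeriv]

lemma Dbar_Dbar_apply (i j : Fin N) (f : smoothFun N M) :
    ∀ y ∈ F.V, K.Dbar e i (K.Dbar e j f) y
      = ∑ l, (K.gMat e y)⁻¹ i l * (F.del l (F.Dbar j f) : M → ℂ) y := fun y hy => by
  simp only [KahlerMetric.Dbar]
  refine Finset.sum_congr rfl fun l _ => ?_
  rw [F.del_eq_dz (fun x hx => F.Dbar_apply j f x hx) l y hy, dz_eq_chartDeriv]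

/-- The derivation `(D^i f) ∂_i`. -/
def X (f : smoothFun N M) : Derivation ℂ (smoothFun N M) (smoothFun N M) :=
  ∑ i, F.D i f • F.del i

/-- The derivation `(D^{ī} f) ∂_{ī}`. -/
def Xbar (f : smoothFun N M) : Derivation ℂ (smoothFun N M) (smoothFun N M) :=
  ∑ i, F.Dbar i f • F.delbar i

lemma sum_smul_derivation_apply {A : Type*} [CommRing A] [Algebra ℂ A] {ι : Type*} (s : Finset ι)
    (c : ι → A) (δ : ι → Derivation ℂ A A) (g : A) :
    (∑ i ∈ s, c i • δ i) g = ∑ i ∈ s, c i * δ i g := by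
  induction s using Finset.cons_induction with
  | empty => simp
  | cons a s ha ih => simp [Finset.sum_cons, ih]

lemma X_apply (f g : smoothFun N M) (y : M) :
    (F.X f g : M → ℂ) y = ∑ i, (F.D i f : M → ℂ) y * (F.del i g : M → ℂ) y := by
  rw [X, sum_smul_derivation_apply]
  simp

lemma Xbar_apply (f g : smoothFun N M) (y : M) :
    (F.Xbar f g : M → ℂ) y = ∑ i, (F.Dbar i f : M → ℂ) y * (F.delbar i g : M → ℂ) y := by
  rw [Xbar, sum_smul_derivation_apply]
  simp

/-- Both sides are `g^{ī j} ∂_j f ∂_{ī} g`. This turns the term `C_1(g, f)` of the antisymmetrised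
product into a derivation in `g`. -/
lemma Xbar_eq_X_swap (f g : smoothFun N M) (y : M) :
    (F.Xbar f g : M → ℂ) y = (F.X g f : M → ℂ) y := by
  simp only [X_apply, Xbar_apply, D, Dbar, AddSubmonoidClass.coe_finsetSum, Finset.sum_apply,
    Finset.sum_mul, Subalgebra.coe_mul, Pi.mul_apply]
  rw [Finset.sum_comm]
  exact Finset.sum_congr rfl fun i _ => Finset.sum_congr rfl fun j _ => by ring

lemma X_z (f : smoothFun N M) (j : Fin N) :
    ∀ y ∈ F.V, (F.X f (F.z j) : M → ℂ) y = (F.D j f : M → ℂ) y := fun y hy => by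
  simp [X_apply, F.del_z _ _ y hy]

lemma X_zbar (f : smoothFun N M) (j : Fin N) :
    ∀ y ∈ F.V, (F.X f (F.zbar j) : M → ℂ) y = 0 := fun y hy => by
  simp [X_apply, F.del_zbar _ _ y hy]

lemma Xbar_z (f : smoothFun N M) (j : Fin N) :
    ∀ y ∈ F.V, (F.Xbar f (F.z j) : M → ℂ) y = 0 := fun y hy => by
  simp [Xbar_apply, F.delbar_z _ _ y hy]

lemma Xbar_zbar (f : smoothFun N M) (j : Fin N) :
    ∀ y ∈ F.V, (F.Xbar f (F.zbar j) : M → ℂ) y = (F.Dbar j f : M → ℂ) y := fun y hy => by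
  simp [Xbar_apply, F.delbar_zbar _ _ y hy]

section

variable [IsManifold 𝓘(ℂ, Cn N) ω M]

lemma isUnit_det_gMat (he : e ∈ holCharts N M) {y : M} (hy : y ∈ F.V) :
    IsUnit (K.gMat e y).det :=
  isUnit_iff_ne_zero.2 (det_gMat_ne_zero _ he (F.subset_source hy))

/-- The inverse metric in `D^i f` cancels `∂_i w_l = g_{i l̄}`. This is the condition `X ψ = δ p` of
`intertwinesOn_firstOrderOp`. -/
lemma X_w (he : e ∈ holCharts N M) (f : smoothFun N M) (l : Fin N) :
    ∀ y ∈ F.V, (F.X f (F.w l) : M → ℂ) y = (F.delbar l f : M → ℂ) y := fun y hy => by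
  have h := congrArg (fun A => Matrix.vecMul (fun j => (F.delbar j f : M → ℂ) y) A l)
    (Matrix.nonsing_inv_mul _ (F.isUnit_det_gMat he hy))
  simp only [← Matrix.vecMul_vecMul, Matrix.vecMul_one] at h
  rw [← h]
  simp [X_apply, D, F.del_w he _ _ y hy, Matrix.vecMul, dotProduct, F.ginv_apply _ _ y hy,
    mul_comm]

lemma Xbar_v (he : e ∈ holCharts N M) (f : smoothFun N M) (l : Fin N) :
    ∀ y ∈ F.V, (F.Xbar f (F.v l) : M → ℂ) y = (F.del l f : M → ℂ) y := fun y hy => by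
  have h := congrArg (fun A => Matrix.mulVec A (fun j => (F.del j f : M → ℂ) y) l)
    (Matrix.mul_nonsing_inv _ (F.isUnit_det_gMat he hy))
  simp only [← Matrix.mulVec_mulVec, Matrix.one_mulVec] at h
  rw [← h]
  simp [Xbar_apply, Dbar, F.delbar_v he _ _ y hy, Matrix.mulVec, dotProduct,
    F.ginv_apply _ _ y hy, mul_comm]

/-- If `D^i D^j f = 0` for all `i`, then `∂_{l̄} D^j f = 0` for all `l`. -/
lemma delbar_D_eq_zero (he : e ∈ holCharts N M) {f : smoothFun N M} {j : Fin N} {y : M}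
    (hy : y ∈ F.V) (h : ∀ i, K.D e i (K.D e j f) y = 0) (l : Fin N) :
    (F.delbar l (F.D j f) : M → ℂ) y = 0 := by
  have h1 : Matrix.vecMul (fun l => (F.delbar l (F.D j f) : M → ℂ) y) (K.gMat e y)⁻¹ = 0 := by
    funext i
    have := h i
    rw [F.D_D_apply i j f y hy] at this
    simpa [Matrix.vecMul, dotProduct, mul_comm] using this
  have h2 := congrArg (fun c => Matrix.vecMul c (K.gMat e y)) h1
  simp only [Matrix.vecMul_vecMul, Matrix.nonsing_inv_mul _ (F.isUnit_det_gMat he hy),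
    Matrix.vecMul_one, Matrix.zero_vecMul] at h2
  exact congrFun h2 l

lemma del_Dbar_eq_zero (he : e ∈ holCharts N M) {f : smoothFun N M} {j : Fin N} {y : M}
    (hy : y ∈ F.V) (h : ∀ i, K.Dbar e i (K.Dbar e j f) y = 0) (l : Fin N) :
    (F.del l (F.Dbar j f) : M → ℂ) y = 0 := by
  have h1 : Matrix.mulVec (K.gMat e y)⁻¹ (fun l => (F.del l (F.Dbar j f) : M → ℂ) y) = 0 := by
    funext i
    have := h i
    rw [F.Dbar_Dbar_apply i j f y hy] at this
    simpa [Matrix.mulVec, dotProduct] using this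
  have h2 := congrArg (fun c => Matrix.mulVec (K.gMat e y) c) h1
  simp only [Matrix.mulVec_mulVec, Matrix.mul_nonsing_inv _ (F.isUnit_det_gMat he hy),
    Matrix.one_mulVec, Matrix.mulVec_zero] at h2
  exact congrFun h2 l

end

/-! ### Star multiplication in a frame -/

variable [T2Space M] [IsManifold 𝓘(ℂ, Cn N) ω M] {S : StarProduct K}

lemma intertwinesOn_leftOp (he : e ∈ holCharts N M) (hsep : S.SeparatesVariables)
    (hKar : S.KarabegovCondition) (P : Formal N M) :
    IntertwinesOn F.V F.zbar F.w F.delbar (leftOp S.C P) where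
  isLocalOn := isLocalOn_leftOp S.bidifferential P
  mul_left n l f := hsep.leftOp_mul F.isOpen (F.mdifferentiableOn_conj_zbar he l) P n f
  zero l f := (hKar.leftOp_comm F.isOpen F.isPotentialOn he F.subset_source (F.w_apply l)
    (F.delbar_apply l) P f).1
  succ n l f := (hKar.leftOp_comm F.isOpen F.isPotentialOn he F.subset_source (F.w_apply l)
    (F.delbar_apply l) P f).2 n

/-- `v_l * f = v_l f + ħ ∂_l f` for `v_l = ∂_l Φ`. -/
lemma C_v (he : e ∈ holCharts N M) (hsep : S.SeparatesVariables)
    (hKar : S.KarabegovCondition) (l : Fin N) (n : ℕ) (f : smoothFun N M) :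
    Set.EqOn (S.C n (F.v l) f : M → ℂ)
      (firstOrderOp (fun n => if n = 0 then F.v l else 0) (fun n => if n = 0 then F.del l else 0)
        n f) F.V := by
  -- `v_l + ħ ∂_l` has the value `v_l` on `1` and satisfies the relations that characterise
  -- `L_{v_l}`: `∂_l z̄^m = 0`, `∂_l w_m = g_{l m̄} = ∂_{m̄} v_l`, and `∂_l` commutes with `∂_{m̄}`.
  have h := (F.intertwinesOn_leftOp he hsep hKar (PowerSeries.C (F.v l))).eqOn F.isOpen
    (F.hadamardOn_zbar_w he) (intertwinesOn_firstOrderOp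
      (p := fun n => if n = 0 then F.v l else 0) (X := fun n => if n = 0 then F.del l else 0)
      (fun n m y hy => ?_) (fun n m y hy => ?_) (fun n m f y hy => ?_)) (fun n y hy => ?_) n f
  · simpa only [leftOp_C] using h
  · by_cases hn : n = 0
    · simp [hn, F.del_zbar _ _ y hy]
    · simp [hn]
  · by_cases hn : n = 0
    · simp [hn, F.del_w he _ _ y hy, F.delbar_v he _ _ y hy]
    · simp [hn]
  · by_cases hn : n = 0
    · simp [hn, F.del_delbar he l m f y hy]
    · simp [hn]
  · rw [S.leftOp_one]
    rcases n with _ | _ | n <;> simp [firstOrderOp, PowerSeries.coeff_C]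

/-- The mirror image of Karabegov's condition is not an axiom. It follows because `R_P` commutes
with `L_{v_l}`, which is `v_l + ħ ∂_l` on the frame. -/
lemma intertwinesOn_rightOp (he : e ∈ holCharts N M) (hsep : S.SeparatesVariables)
    (hKar : S.KarabegovCondition) (P : Formal N M) :
    IntertwinesOn F.V F.z F.v F.del (rightOp S.C P) := by
  have h := fun l => comm_of_eq_firstOrder F.isOpen (T := rightOp S.C P)
    (E := fun k => S.C k (F.v l)) (b := F.v l) (δ := F.del l)
    (isLocalOn_rightOp S.bidifferential P)
    (fun f y _ => by simp [S.C_zero])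
    (fun f y hy => by simpa [firstOrderOp] using F.C_v he hsep hKar l 1 f hy)
    (fun k f y hy => by simpa [firstOrderOp] using F.C_v he hsep hKar l (k + 2) f hy)
    (fun n f => S.rightOp_comm_C P (F.v l) f n)
  exact
    { isLocalOn := isLocalOn_rightOp S.bidifferential P
      mul_left := fun n l f => hsep.rightOp_mul F.isOpen (F.mdifferentiableOn_z he l) P n f
      zero := fun l f => (h l).1 f
      succ := fun n l f => (h l).2 n f }

/-- `C_1(f, g) = (D^i f) ∂_i g`. -/
lemma C_one_eq (he : e ∈ holCharts N M) (hsep : S.SeparatesVariables)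
    (hKar : S.KarabegovCondition) (f g : smoothFun N M) :
    ∀ y ∈ F.V, (S.C 1 f g : M → ℂ) y = (F.X f g : M → ℂ) y := by
  have hL := F.intertwinesOn_leftOp he hsep hKar (PowerSeries.C f)
  -- Both `C_1(f, ·)` and `X_f` commute with `z̄^k`, kill `1` and satisfy `T (w_k u) = w_k T u + u
  -- ∂_{k̄} f`, so their difference commutes with `w_k` too.
  have h := (F.hadamardOn_zbar_w he).eq_zero
    (T := S.C 1 f - (F.X f : smoothFun N M →ₗ[ℂ] smoothFun N M))
    (((S.bidifferential 1).isLocalOn f).sub (isLocalOn_derivation _))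
    (fun k u y hy => ?_) (fun k u y hy => ?_) (fun y hy => ?_) g
  · intro y hy
    simpa [sub_eq_zero] using h y hy
  · have := hL.mul_left 1 k u y hy
    rw [leftOp_C] at this
    simp [this, F.X_zbar f k y hy, mul_sub]
  · have := hL.succ 0 k u y hy
    simp only [leftOp_C, S.C_zero, zero_add, Derivation.leibniz, smul_eq_mul, Subalgebra.coe_mul,
      Subalgebra.coe_add, Pi.mul_apply, Pi.add_apply] at this
    simp only [LinearMap.sub_apply, Derivation.coeFn_coe, Derivation.leibniz, smul_eq_mul,
      AddSubgroupClass.coe_sub, Subalgebra.coe_mul, Subalgebra.coe_add, Pi.sub_apply,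
      Pi.mul_apply, Pi.add_apply, F.X_w he f k y hy]
    linear_combination this
  · have := S.leftOp_one (PowerSeries.C f) 1
    rw [leftOp_C] at this
    simp [this]

/-- The Poisson bracket in arbitrary holomorphic coordinates. -/
lemma poisson_eq (he : e ∈ holCharts N M) (hsep : S.SeparatesVariables)
    (hKar : S.KarabegovCondition) (f g : smoothFun N M) :
    ∀ y ∈ F.V, Complex.I * K.poisson f g y = ((F.X f - F.Xbar f) g : M → ℂ) y := fun y hy => by
  -- Coordinate independence of the bracket comes from the axiom on `C_1`, whose value is known in
  -- every frame; no change of variables is computed.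
  have h := congrFun (S.C_one f g) y
  simp only [Pi.sub_apply, Pi.smul_apply, smul_eq_mul] at h
  rw [← h, F.C_one_eq he hsep hKar f g y hy, F.C_one_eq he hsep hKar g f y hy]
  simp [F.Xbar_eq_X_swap]

end CoordFrame

end

section

variable {N : ℕ} {M : Type*} [TopologicalSpace M] [ChartedSpace (Cn N) M]
  {K : KahlerMetric N M} {e : OpenPartialHomeomorph M (Cn N)}

/-! ### The equivalence -/

/-- `[P, f]_* = iħ{P, f}`, order by order in `ħ`. -/
lemma comm_coe_eq_iff (S : StarProduct K) (P : Formal N M) (f : smoothFun N M) :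
    (S.comm P (PowerSeries.C f)).coe = Complex.I • (PowerSeries.X * K.formalPoisson P f) ↔
    ∀ n y, (leftOp S.C P (n + 1) f : M → ℂ) y = (rightOp S.C P (n + 1) f : M → ℂ) y
      + Complex.I * K.poisson (PowerSeries.coeff n P : smoothFun N M) f y := by
  have hc : ∀ n, PowerSeries.coeff n (S.comm P (PowerSeries.C f)).coe
      = (leftOp S.C P n f : M → ℂ) - (rightOp S.C P n f : M → ℂ) := fun n => by
    rw [coeff_coe, StarProduct.comm, map_sub, coeff_starProd_C_right, coeff_starProd_C_left]
    rfl
  have hp : ∀ n, PowerSeries.coeff (n + 1) (Complex.I • (PowerSeries.X * K.formalPoisson P f))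
      = Complex.I • K.poisson (PowerSeries.coeff n P : smoothFun N M) f := fun n => by
    rw [PowerSeries.coeff_smul, PowerSeries.coeff_succ_X_mul, KahlerMetric.formalPoisson,
      PowerSeries.coeff_mk, coeff_coe]
  constructor
  · intro h n y
    have h1 := congrFun (congrArg (PowerSeries.coeff (n + 1)) h) y
    rw [hc, hp] at h1
    simp only [Pi.sub_apply, Pi.smul_apply, smul_eq_mul] at h1
    linear_combination h1
  · intro h
    ext n y
    cases n with
    | zero =>
      rw [hc, PowerSeries.coeff_smul, PowerSeries.coeff_zero_X_mul, S.leftOp_zero,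
        S.rightOp_zero]
      simp [mul_comm]
    | succ n =>
      rw [hc, hp]
      simp [h n y]

variable [T2Space M] [IsManifold 𝓘(ℂ, Cn N) ω M] {S : StarProduct K}

/-- With `Y_n = X - X̄` for the coefficient `P_n`, one has `Y_n z^j = D^j P_n` and `Y_n z̄^j =
-D^{j̄} P_n`. The obstruction lemma `IntertwinesOn.deriv_apply_eq_zero`, used once for `L_P` and
once for `R_P`, shows that these are killed by `∂_{l̄}` and `∂_l` respectively. -/
lemma killingEquations_of_comm_eq (hsep : S.SeparatesVariables) (hKar : S.KarabegovCondition)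
    (P : Formal N M) (h : ∀ f : smoothFun N M, (S.comm P (PowerSeries.C f)).coe
      = Complex.I • (PowerSeries.X * K.formalPoisson P f)) : K.KillingEquations P := by
  intro e he i j n y hy
  obtain ⟨F, hyF⟩ := exists_coordFrame K he hy
  have hY : ∀ n f, ∀ y ∈ F.V, (leftOp S.C P (n + 1) f : M → ℂ) y
      = (rightOp S.C P (n + 1) f : M → ℂ) y
        + ((F.X (PowerSeries.coeff n P) - F.Xbar (PowerSeries.coeff n P)) f : M → ℂ) y :=
    fun n f y hy => by
      rw [(comm_coe_eq_iff S P f).1 (h f) n y, F.poisson_eq he hsep hKar _ f y hy]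
  have hL := F.intertwinesOn_leftOp he hsep hKar P
  have hR := F.intertwinesOn_rightOp he hsep hKar P
  have h1 : ∀ l, ∀ y ∈ F.V, (F.delbar l (F.D j (PowerSeries.coeff n P)) : M → ℂ) y = 0 := by
    intro l y hy
    rw [← hL.deriv_apply_eq_zero F.isOpen (fun n f => hR.mul_left n j f)
      (fun l => F.delbar_z l j) hY n l y hy]
    refine derivation_congr_on _ F.isOpen (fun x hx => ?_) hy
    simp [F.X_z _ _ x hx, F.Xbar_z _ _ x hx]
  have h2 : ∀ l, ∀ y ∈ F.V, (F.del l (F.Dbar j (PowerSeries.coeff n P)) : M → ℂ) y = 0 := by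
    intro l y hy
    -- Now `R_P` is the intertwining operator and `L_P` the one commuting with `z̄^j`, so the vector
    -- field changes sign.
    rw [← hR.deriv_apply_eq_zero F.isOpen (fun n f => hL.mul_left n j f)
      (fun l => F.del_zbar l j)
      (Y := fun n => F.Xbar (PowerSeries.coeff n P) - F.X (PowerSeries.coeff n P))
      (fun n f y hy => by rw [hY n f y hy]; simp; ring) n l y hy]
    refine derivation_congr_on _ F.isOpen (fun x hx => ?_) hy
    simp [F.X_zbar _ _ x hx, F.Xbar_zbar _ _ x hx]
  rw [coeff_coe, F.D_D_apply i j _ y hyF, F.Dbar_Dbar_apply i j _ y hyF]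
  exact ⟨Finset.sum_eq_zero fun l _ => by rw [h1 l y hyF, mul_zero],
    Finset.sum_eq_zero fun l _ => by rw [h2 l y hyF, mul_zero]⟩

/-- The Killing equations enter only through `[X_P, ∂_{l̄}] = 0`: the coefficients `D^j P` of `X_P`
are killed by `∂_{l̄}`. The other relations for `P + ħ X_P` hold for every `P`, and uniqueness
identifies it with `L_P`. -/
lemma leftOp_eq_of_killingEquations (hsep : S.SeparatesVariables) (hKar : S.KarabegovCondition)
    {P : Formal N M} (hP : K.KillingEquations P) (he : e ∈ holCharts N M) (F : CoordFrame K e)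
    (n : ℕ) (f : smoothFun N M) :
    Set.EqOn (leftOp S.C P n f : M → ℂ)
      (firstOrderOp (fun n => PowerSeries.coeff n P) (fun n => F.X (PowerSeries.coeff n P)) n f)
      F.V := by
  refine (F.intertwinesOn_leftOp he hsep hKar P).eqOn F.isOpen (F.hadamardOn_zbar_w he)
    (intertwinesOn_firstOrderOp (fun n l => F.X_zbar _ l) (fun n l => F.X_w he _ l)
      (fun n l f y hy => ?_)) (fun n y _ => ?_) n f
  · have hD : ∀ j, (F.delbar l (F.D j (PowerSeries.coeff n P)) : M → ℂ) y = 0 := fun j =>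
      F.delbar_D_eq_zero he hy (fun i => by
        simpa only [coeff_coe] using (hP e he i j n y (F.subset_source hy)).1) l
    rw [F.X_apply, CoordFrame.X, CoordFrame.sum_smul_derivation_apply]
    simp only [map_sum, Derivation.leibniz, smul_eq_mul, AddSubmonoidClass.coe_finsetSum,
      Finset.sum_apply, Subalgebra.coe_add, Subalgebra.coe_mul, Pi.add_apply, Pi.mul_apply, hD,
      mul_zero, add_zero]
    exact Finset.sum_congr rfl fun i _ => by rw [F.del_delbar he i l f y hy]
  · rw [S.leftOp_one]
    cases n <;> simp [firstOrderOp]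

lemma rightOp_eq_of_killingEquations (hsep : S.SeparatesVariables) (hKar : S.KarabegovCondition)
    {P : Formal N M} (hP : K.KillingEquations P) (he : e ∈ holCharts N M) (F : CoordFrame K e)
    (n : ℕ) (f : smoothFun N M) :
    Set.EqOn (rightOp S.C P n f : M → ℂ)
      (firstOrderOp (fun n => PowerSeries.coeff n P) (fun n => F.Xbar (PowerSeries.coeff n P))
        n f) F.V := by
  refine (F.intertwinesOn_rightOp he hsep hKar P).eqOn F.isOpen (F.hadamardOn_z_v he)
    (intertwinesOn_firstOrderOp (fun n l => F.Xbar_z _ l) (fun n l => F.Xbar_v he _ l)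
      (fun n l f y hy => ?_)) (fun n y _ => ?_) n f
  · have hD : ∀ j, (F.del l (F.Dbar j (PowerSeries.coeff n P)) : M → ℂ) y = 0 := fun j =>
      F.del_Dbar_eq_zero he hy (fun i => by
        simpa only [coeff_coe] using (hP e he i j n y (F.subset_source hy)).2) l
    rw [F.Xbar_apply, CoordFrame.Xbar, CoordFrame.sum_smul_derivation_apply]
    simp only [map_sum, Derivation.leibniz, smul_eq_mul, AddSubmonoidClass.coe_finsetSum,
      Finset.sum_apply, Subalgebra.coe_add, Subalgebra.coe_mul, Pi.add_apply, Pi.mul_apply, hD,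
      mul_zero, add_zero]
    exact Finset.sum_congr rfl fun i _ => by rw [F.del_delbar he l i f y hy]
  · rw [S.rightOp_one]
    cases n <;> simp [firstOrderOp]

lemma comm_eq_of_killingEquations (hsep : S.SeparatesVariables) (hKar : S.KarabegovCondition)
    {P : Formal N M} (hP : K.KillingEquations P) (f : smoothFun N M) :
    (S.comm P (PowerSeries.C f)).coe = Complex.I • (PowerSeries.X * K.formalPoisson P f) := by
  refine (comm_coe_eq_iff S P f).2 fun n y => ?_
  have he : chartAt (Cn N) y ∈ holCharts N M := IsManifold.chart_mem_maximalAtlas y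
  obtain ⟨F, hy⟩ := exists_coordFrame K he (mem_chart_source _ y)
  rw [leftOp_eq_of_killingEquations hsep hKar hP he F (n + 1) f hy,
    rightOp_eq_of_killingEquations hsep hKar hP he F (n + 1) f hy,
    F.poisson_eq he hsep hKar _ f y hy]
  simp [firstOrderOp]

lemma poisson_leibniz (K : KahlerMetric N M) (p : M → ℂ) (f g : smoothFun N M) (y : M) :
    K.poisson p ((f * g : smoothFun N M) : M → ℂ) y
      = (f : M → ℂ) y * K.poisson p g y + (g : M → ℂ) y * K.poisson p f y := by
  have he : chartAt (Cn N) y ∈ holCharts N M := IsManifold.chart_mem_maximalAtlas y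
  have h := fun s k => chartDeriv_mul (s := s) (k := k) he (mem_chart_source _ y)
    (smoothFun_smoothAt f y) (smoothFun_smoothAt g y)
  simp only [KahlerMetric.poisson, dz_eq_chartDeriv, dzbar_eq_chartDeriv, Subalgebra.coe_mul, h,
    Finset.mul_sum, ← Finset.sum_add_distrib]
  exact Finset.sum_congr rfl fun i _ => by ring

/-- The order-zero coefficient of the commutator vanishes, and the one of order `n + 1` is `i{P_n,
·}`. The linear map is taken from the star product itself, which already has smooth values, so the
bracket supplies only the Leibniz rule. -/
lemma exists_derivation_coeff_comm {P : Formal N M}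
    (h : ∀ f : smoothFun N M, (S.comm P (PowerSeries.C f)).coe
      = Complex.I • (PowerSeries.X * K.formalPoisson P f)) (n : ℕ) :
    ∃ V : Derivation ℂ (smoothFun N M) (smoothFun N M),
      ∀ f : smoothFun N M, PowerSeries.coeff n (S.comm P (PowerSeries.C f)) = V f := by
  have hc : ∀ f, PowerSeries.coeff n (S.comm P (PowerSeries.C f))
      = leftOp S.C P n f - rightOp S.C P n f := fun f => by
    rw [StarProduct.comm, map_sub, coeff_starProd_C_right, coeff_starProd_C_left]
  refine ⟨Derivation.mk' (leftOp S.C P n - rightOp S.C P n) fun f g => ?_, fun f => hc f⟩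
  refine Subtype.ext (funext fun y => ?_)
  cases n with
  | zero =>
    simp only [LinearMap.sub_apply, S.leftOp_zero, S.rightOp_zero]
    simp only [mul_comm _ (PowerSeries.coeff 0 P), sub_self, smul_zero, add_zero]
  | succ n =>
    have h1 := fun f => (comm_coe_eq_iff S P f).1 (h f) n y
    simp only [LinearMap.sub_apply, AddSubgroupClass.coe_sub, Subalgebra.coe_add, smul_eq_mul,
      MulMemClass.coe_mul, Pi.sub_apply, Pi.add_apply, Pi.mul_apply]
    rw [h1 (f * g), h1 f, h1 g, poisson_leibniz]
    ring

end

end KahlerStar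

end

open KahlerStar in
theorem mainTheorem2 {N : ℕ} {M : Type*} [TopologicalSpace M] [T2Space M]
    [ChartedSpace (Cn N) M] [IsManifold 𝓘(ℂ, Cn N) ω M]
    (K : KahlerMetric N M) (S : StarProduct K)
    (hsep : S.SeparatesVariables) (hKar : S.KarabegovCondition)
    (P : Formal N M) :
    ((∀ f : smoothFun N M,
        (S.comm P (PowerSeries.C f)).coe
          = Complex.I • (PowerSeries.X * K.formalPoisson P f))
      ↔ K.KillingEquations P) ∧
    (K.KillingEquations P →
      ∀ n, ∃ V : Derivation ℂ (smoothFun N M) (smoothFun N M),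
        ∀ f : smoothFun N M, PowerSeries.coeff n (S.comm P (PowerSeries.C f)) = V f) :=
  ⟨⟨killingEquations_of_comm_eq hsep hKar P, fun hP => comm_eq_of_killingEquations hsep hKar hP⟩,
    fun hP => exists_derivation_coeff_comm (comm_eq_of_killingEquations hsep hKar hP)⟩
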